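/- **Discrete Jordan Curve Theorem.** A *hypermap* is a triple $M=(D,\alpha_0,\alpha_1)$ with $D$ a finite set (of *darts*) and $\alpha_0,\alpha_1$ permutations of $D$. Its *edges*, *vertices* and *faces* are the orbits of $\alpha_0$, of $\alpha_1$ and of $\phi=\alpha_1^{-1}\circ\alpha_0^{-1}$; its *components* are the orbits of the pair $\alpha_0,\alpha_1$. If $d,e,v,f,c$ are the numbers of darts, edges, vertices, faces and components, then $\chi=v+e+f-d$, and $M$ is *planar* if its genus $c-\chi/2$ is $0$. A *double-link* is a pair $(y,y')$ of two different darts of the same edge. A *ring of faces* in $M$ is a non-empty sequence $R=((y_i,y'_i))_{1\le i\le n}$ of double-links such that, with $E_i$ and $F_i$ the edge and the face of $y_i$: (0) $E_i\neq E_j$ for $i\neq j$ (unicity); (1) $y'_i\in F_{i+1}$ for $1\le i<n$ (continuity); (2) $y'_n\in F_1$ (circularity); (3) $F_i\ne F_j$ for $i\neq j$ (simplicity). The *break of $M$ along $R$* is $M'=(D,\alpha_{0,n},\alpha_1)$, where $\alpha_{0,0}=\alpha_0$ and, for $1\le i\le n$, $\alpha_{0,i}=(y_i\;y'_i)\circ\alpha_{0,i-1}$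 with $(y_i\;y'_i)$ the transposition. **(A)** Let $M$ be a planar hypermap with $c$ components, $R$ a ring of faces in $M$ and $M'$ the break of $M$ along $R$. Then $M'$ has exactly $c+1$ components. **(B)** The same holds for hypermaps given as terms with open orbits (the form proved in Coq). Darts are now natural numbers, and $0$ is the nil dart. A *free map* is a term built from the void map $V$ by insertions $I(m,x)$ of a dart $x$ and links $L(m,k,x,y)$, $k\in\{0,1\}$, making $y$ the $k$-successor $A_k(x)$ of $x$ and $x$ the $k$-predecessor of $y$. The predicate $\mathrm{inv\_hmap}(m)$ says that each inserted dart is non-nil and new, and that each $L(m,k,x,y)$ in the term links existing darts $x,y$ of $m$ such that $x$ has no $k$-successor, $y$ has no $k$-predecessor, and $y$ is not the first dart $\mathrm{bottom}_k(x)$ of the open $k$-orbit (chain of $k$-links) of $x$. The closure $cA_k$ of $A_k$ sends the last dart of each open $k$-orbit to its first dart; edges, vertices and faces are the orbits of $cA_0$, of $cA_1$ and of $cA_1^{-1}\circ cA_0^{-1}$, components are the classes of the equivalence generated by the links, $\mathrm{nc}(m)$ is the number of components, and $\mathrm{planar}(m)$ means $\mathrm{nc}(m)-\lfloor\chi/2\rfloor=0$.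 A list $l$ of pairs $(x_i,b_i)$, $1\le i\le n$, of a dart and a Boolean codes the double-links $(y_i,y'_i)=(A_0(x_i),\mathrm{bottom}_0(x_i))$ if $b_i$ is true, and $(y_i,y'_i)=(\mathrm{bottom}_0(x_i),A_0(x_i))$ if $b_i$ is false. The predicate $\mathrm{ring}(m,l)$ says that $l$ is non-empty, that each $x_i$ has a $0$-successor, and that (0) the edges of the $x_i$ are pairwise distinct, and (1) $y'_i$ lies in the face of $y_{i+1}$ for $i<n$, (2) $y'_n$ lies in the face of $y_1$, (3) the faces of the $y_i$ are pairwise distinct. $\mathrm{Bl}(m,l)$ is the free map obtained from $m$ by deleting, one after the other, the $0$-links that start from $x_1,\dots,x_n$. Then, for all $m$ and $l$, $$\mathrm{inv\_hmap}(m)\wedge\mathrm{planar}(m)\wedge\mathrm{ring}(m,l)\;\Longrightarrow\;\mathrm{nc}(\mathrm{Bl}(m,l))=\mathrm{nc}(m)+1 .$$ -/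

import Mathlib

/-- A hypermap `(D, α₀, α₁)` on a set of darts `D` (finite wherever it is used). -/
structure Hypermap (D : Type*) where
  /-- the permutation `α₀` -/
  α₀ : Equiv.Perm D
  /-- the permutation `α₁` -/
  α₁ : Equiv.Perm D

/-- The orbit of `x` under a set `fs` of functions: all elements accessible from `x` by any
composition of functions of `fs`. -/
def dartOrbit {D : Type*} (fs : Set (D → D)) (x : D) : Set D :=
  {y | Relation.ReflTransGen (fun a b => ∃ f ∈ fs, f a = b) x y}

namespace Hypermap

variable {D : Type*}

/-- `φ = α₁⁻¹ ∘ α₀⁻¹`, whose orbits are the faces. -/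
def φ (M : Hypermap D) : Equiv.Perm D := M.α₁⁻¹ * M.α₀⁻¹

/-- The edge of a dart. -/
def edge (M : Hypermap D) (x : D) : Set D := dartOrbit {⇑M.α₀} x

/-- The vertex of a dart. -/
def vertex (M : Hypermap D) (x : D) : Set D := dartOrbit {⇑M.α₁} x

/-- The face of a dart. -/
def face (M : Hypermap D) (x : D) : Set D := dartOrbit {⇑M.φ} x

/-- The (connected) component of a dart. -/
def component (M : Hypermap D) (x : D) : Set D := dartOrbit {⇑M.α₀, ⇑M.α₁} x

/-- The number of darts. -/
noncomputable def numDarts (_M : Hypermap D) : ℕ := Nat.card D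

/-- The number of edges. -/
noncomputable def numEdges (M : Hypermap D) : ℕ := (Set.range M.edge).ncard

/-- The number of vertices. -/
noncomputable def numVertices (M : Hypermap D) : ℕ := (Set.range M.vertex).ncard

/-- The number of faces. -/
noncomputable def numFaces (M : Hypermap D) : ℕ := (Set.range M.face).ncard

/-- The number of connected components. -/
noncomputable def numComponents (M : Hypermap D) : ℕ := (Set.range M.component).ncard

/-- The Euler characteristic `v + e + f - d`. -/
noncomputable def eulerChar (M : Hypermap D) : ℤ :=
  (M.numVertices : ℤ) + M.numEdges + M.numFaces - M.numDarts

/-- The genus `c - χ / 2`, with an exact division. -/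
noncomputable def genus (M : Hypermap D) : ℚ :=
  (M.numComponents : ℚ) - (M.eulerChar : ℚ) / 2

/-- Planarity: the genus is zero. -/
def Planar (M : Hypermap D) : Prop := M.genus = 0

/-- A double-link: a pair of two (different) darts of the same edge. -/
def IsDoubleLink (M : Hypermap D) (p : D × D) : Prop := p.1 ≠ p.2 ∧ p.2 ∈ M.edge p.1

/-- The sets of darts (faces) `F` and `F'` are adjacent by the double-link `p`. -/
def Adjacent (F F' : Set D) (p : D × D) : Prop := p.1 ∈ F ∧ p.2 ∈ F'

/-- A ring of faces `(y₁, y'₁), …, (yₙ, y'ₙ)`. -/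
structure IsRing (M : Hypermap D) (R : List (D × D)) : Prop where
  nonempty : R ≠ []
  doubleLink : ∀ p ∈ R, M.IsDoubleLink p
  unicity : R.Pairwise fun p q => M.edge p.1 ≠ M.edge q.1
  continuity : R.IsChain fun p q => Adjacent (M.face p.1) (M.face q.1) p
  circularity : Adjacent (M.face (R.getLast nonempty).1) (M.face (R.head nonempty).1)
    (R.getLast nonempty)
  simplicity : R.Pairwise fun p q => M.face p.1 ≠ M.face q.1

open Classical in
/-- The break of one pair `(y, y')`: the new `α₀` sends `z` to `y'` if `α₀ z = y`, to `y` if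
`α₀ z = y'`, and to `α₀ z` otherwise (this is `Equiv.swap y y'` after `α₀`). -/
noncomputable def breakLink (M : Hypermap D) (p : D × D) : Hypermap D where
  α₀ := M.α₀.trans (Equiv.swap p.1 p.2)
  α₁ := M.α₁

/-- The break along a sequence of double-links, one after the other from the first. -/
noncomputable def breakAlong (M : Hypermap D) (R : List (D × D)) : Hypermap D :=
  R.foldl breakLink M

open Classical in
theorem breakLink_α₀_apply (M : Hypermap D) (y y' z : D) :
    (M.breakLink (y, y')).α₀ z =
      if M.α₀ z = y then y' else if M.α₀ z = y' then y else M.α₀ z := by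
  simp only [breakLink, Equiv.trans_apply, Equiv.swap_apply_def]

end Hypermap

/-! ### Free maps: hypermaps as terms with open orbits -/

/-- The two dimensions. -/
inductive Dim : Type
  | zero
  | one
  deriving DecidableEq

/-- Darts of free maps are natural numbers. -/
abbrev Dart : Type := ℕ

/-- The exceptional dart. -/
def nilDart : Dart := 0

/-- Free maps: the void map, the insertion of a dart, the `k`-linking of a dart to another. -/
inductive FMap : Type
  | V : FMap
  | I : FMap → Dart → FMap
  | L : FMap → Dim → Dart → Dart → FMap

namespace FMap

/-- The dart `z` exists in the map. -/
def exd : FMap → Dart → Prop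
  | V, _ => False
  | I m x, z => z = x ∨ exd m z
  | L m _ _ _, z => exd m z

/-- The `k`-successor of `z` in its open orbit, or `nilDart`. -/
def A : FMap → Dim → Dart → Dart
  | V, _, _ => nilDart
  | I m _, k, z => A m k z
  | L m k₀ x y, k, z => if k = k₀ then (if z = x then y else A m k z) else A m k z

/-- The `k`-predecessor of `z` in its open orbit, or `nilDart`. -/
def A_1 : FMap → Dim → Dart → Dart
  | V, _, _ => nilDart
  | I m _, k, z => A_1 m k z
  | L m k₀ x y, k, z => if k = k₀ then (if z = y then x else A_1 m k z) else A_1 m k z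

/-- `z` has a `k`-successor. -/
def succ (m : FMap) (k : Dim) (z : Dart) : Prop := A m k z ≠ nilDart

/-- `z` has a `k`-predecessor. -/
def pred (m : FMap) (k : Dim) (z : Dart) : Prop := A_1 m k z ≠ nilDart

/-- The last dart of the open `k`-orbit of `z`. -/
def top : FMap → Dim → Dart → Dart
  | V, _, _ => nilDart
  | I m x, k, z => if z = x then x else top m k z
  | L m k₀ x y, k, z =>
      if k = k₀ then (if top m k z = x then top m k y else top m k z) else top m k z

/-- The first dart of the open `k`-orbit of `z`. -/
def bottom : FMap → Dim → Dart → Dart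
  | V, _, _ => nilDart
  | I m x, k, z => if z = x then x else bottom m k z
  | L m k₀ x y, k, z =>
      if k = k₀ then (if bottom m k z = y then bottom m k x else bottom m k z)
      else bottom m k z

/-- The closure of `A`: the last dart of an open orbit is sent to the first one. -/
def cA (m : FMap) (k : Dim) (z : Dart) : Dart :=
  if A m k z = nilDart then bottom m k z else A m k z

/-- The closure of `A_1`: the first dart of an open orbit is sent to the last one. -/
def cA_1 (m : FMap) (k : Dim) (z : Dart) : Dart :=
  if A_1 m k z = nilDart then top m k z else A_1 m k z

/-- Precondition for the insertion of a dart. -/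
def prec_I (m : FMap) (x : Dart) : Prop := x ≠ nilDart ∧ ¬ exd m x

/-- Precondition for the linking of two darts. -/
def prec_L (m : FMap) (k : Dim) (x y : Dart) : Prop :=
  exd m x ∧ exd m y ∧ ¬ succ m k x ∧ ¬ pred m k y ∧ cA m k x ≠ y

/-- The invariant of hypermaps. -/
def inv_hmap : FMap → Prop
  | V => True
  | I m x => inv_hmap m ∧ prec_I m x
  | L m k x y => inv_hmap m ∧ prec_L m k x y

/-- The closed traversal of faces. -/
def cF (m : FMap) (z : Dart) : Dart := cA_1 m Dim.one (cA_1 m Dim.zero z)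

/-- There is a path from the existing dart `z` to `t` in an orbit of `f`. -/
def expo (m : FMap) (f : Dart → Dart) (z t : Dart) : Prop := exd m z ∧ ∃ i : ℕ, f^[i] z = t

/-- `t` is in the edge of `z`. -/
def expe (m : FMap) (z t : Dart) : Prop := expo m (cA m Dim.zero) z t

/-- `t` is in the vertex of `z`. -/
def expv (m : FMap) (z t : Dart) : Prop := expo m (cA m Dim.one) z t

/-- `t` is in the face of `z`. -/
def expf (m : FMap) (z t : Dart) : Prop := expo m (cF m) z t

/-- `z` and `t` are in the same connected component. -/
def eqc : FMap → Dart → Dart → Prop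
  | V, _, _ => False
  | I m x, z, t => (z = x ∧ t = x) ∨ eqc m z t
  | L m _ x y, z, t => eqc m z t ∨ (eqc m z x ∧ eqc m y t) ∨ (eqc m z y ∧ eqc m x t)

/-- The number of classes of existing darts for a relation `r`. -/
noncomputable def numClasses (m : FMap) (r : Dart → Dart → Prop) : ℤ :=
  (((fun z => {t | r z t}) '' {z | exd m z}).ncard : ℤ)

/-- The number of darts. -/
noncomputable def nd (m : FMap) : ℤ := ({z | exd m z}.ncard : ℤ)

/-- The number of edges. -/
noncomputable def ne (m : FMap) : ℤ := numClasses m (expe m)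

/-- The number of vertices. -/
noncomputable def nv (m : FMap) : ℤ := numClasses m (expv m)

/-- The number of faces. -/
noncomputable def nf (m : FMap) : ℤ := numClasses m (expf m)

/-- The number of connected components. -/
noncomputable def nc (m : FMap) : ℤ := numClasses m (eqc m)

/-- The Euler characteristic. -/
noncomputable def ec (m : FMap) : ℤ := nv m + ne m + nf m - nd m

/-- The genus (integer division, as in the integer ring of Coq). -/
noncomputable def genus (m : FMap) : ℤ := nc m - ec m / 2

/-- Planarity. -/
def planar (m : FMap) : Prop := genus m = 0

/-- Forward break of the latest `k`-link inserted for the dart `z`. -/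
def B : FMap → Dim → Dart → FMap
  | V, _, _ => V
  | I m x, k, z => I (B m k z) x
  | L m k₀ x y, k, z =>
      if k = k₀ then (if x = z then m else L (B m k z) k₀ x y) else L (B m k z) k₀ x y

/-- Break of all the `0`-links that start from the darts of a list. -/
def Bl : FMap → List (Dart × Bool) → FMap
  | m, [] => m
  | m, xb :: l => Bl (B m Dim.zero xb.1) l

/-- The edges of the darts of the list are distinct from the edge of `x`. -/
def distinct_edge_list (m : FMap) (x : Dart) : List (Dart × Bool) → Prop
  | [] => True
  | xb :: l => distinct_edge_list m x l ∧ ¬ expe m x xb.1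

/-- Condition (0), unicity; every dart of the list has a `0`-successor. -/
def pre_ring0 (m : FMap) : List (Dart × Bool) → Prop
  | [] => True
  | xb :: l => pre_ring0 m l ∧ distinct_edge_list m xb.1 l ∧ succ m Dim.zero xb.1

/-- The representative of the face on the left of the double-link coded by `(x, b)`. -/
def faceDart (m : FMap) (xb : Dart × Bool) : Dart :=
  if xb.2 = true then A m Dim.zero xb.1 else bottom m Dim.zero xb.1

/-- The other dart of the double-link coded by `(x, b)`. -/
def otherDart (m : FMap) (xb : Dart × Bool) : Dart :=
  if xb.2 = true then bottom m Dim.zero xb.1 else A m Dim.zero xb.1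

/-- The faces identified by `xb` and `xb'` are adjacent along the link of `xb`. -/
def adjacent_faces (m : FMap) (xb xb' : Dart × Bool) : Prop :=
  expf m (otherDart m xb) (faceDart m xb')

/-- Condition (1), continuity. -/
def pre_ring1 (m : FMap) : List (Dart × Bool) → Prop
  | [] => True
  | [_] => True
  | xb :: xb' :: l => pre_ring1 m (xb' :: l) ∧ adjacent_faces m xb xb'

/-- Condition (2), circularity. -/
def pre_ring2 (m : FMap) : List (Dart × Bool) → Prop
  | [] => True
  | [xb] => expf m (A m Dim.zero xb.1) (bottom m Dim.zero xb.1)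
  | xb :: xb' :: l => adjacent_faces m ((xb' :: l).getLast (List.cons_ne_nil xb' l)) xb

/-- The face identified by `xb` is distinct from all the faces of the list. -/
def distinct_face_list (m : FMap) (xb : Dart × Bool) : List (Dart × Bool) → Prop
  | [] => True
  | xb' :: l => distinct_face_list m xb l ∧ ¬ expf m (faceDart m xb) (faceDart m xb')

/-- Condition (3), simplicity. -/
def pre_ring3 (m : FMap) : List (Dart × Bool) → Prop
  | [] => True
  | xb :: l => pre_ring3 m l ∧ distinct_face_list m xb l

/-- Rings of faces in a free map. -/
def ring (m : FMap) (l : List (Dart × Bool)) : Prop :=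
  l ≠ [] ∧ pre_ring0 m l ∧ pre_ring1 m l ∧ pre_ring2 m l ∧ pre_ring3 m l

end FMap

/-! ### Counting the classes of setoids and the cycles of permutations -/

/-! Everything rests on one fact about permutations: composing `σ` with the transposition of `y ≠
y'` splits their cycle in two if they share one, and joins their two cycles otherwise. A break
composes `α₀` with a transposition on the left, and since `φ⁻¹ = α₀ ∘ α₁` it does the same to `φ⁻¹`.
Hence breaking a double-link always adds one edge, and it adds or removes one face according to
whether `y` and `y'` lie in the same face or not.

In a ring with at least two faces, `y₁` and `y'₁` lie in different faces. Breaking this link merges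
the two faces, so `χ` is unchanged; the merged face still joins `y₁` to `y'₁`, so the components are
unchanged and planarity is kept. What remains is a ring with one face fewer (`IsRing.breakLink`).
When a single link is left, its two darts share a face, so `χ` grows by 2. The genus of the broken
map is non-negative (`exists_two_mul_numComponents_eq`), so at least one component appears; removing
one link creates at most one (`numComponents_breakLink_le`).

For free maps, `cA` gives permutations of the existing darts, and deleting a `0`-link composes `cA`
with exactly the transposition of the coded double-link (`inv_hmap_B_and_cA_B`). The relation
`Represents` carries components, planarity, rings and breaks from terms to hypermaps, which reduces
(B) to (A). -/

theorem Setoid.ncard_range_eq_card_quotient {D β : Type*} (s : Setoid D) (F : D → β)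
    (h : ∀ a b, F a = F b ↔ s a b) : (Set.range F).ncard = Nat.card (Quotient s) := by
  have hs : Setoid.ker F = s := Setoid.ext fun a b => h a b
  rw [← hs, ← Nat.card_coe_set_eq]
  exact (Nat.card_congr (Setoid.quotientKerEquivRange F)).symm

/-- The setoid obtained from `s` by merging the classes of `y` and `y'`. -/
def Setoid.merge {D : Type*} (s : Setoid D) (y y' : D) : Setoid D where
  r a b := s a b ∨ (s a y ∧ s b y') ∨ (s a y' ∧ s b y) ∨ (s a y ∧ s b y) ∨ (s a y' ∧ s b y')
  iseqv :=
    { refl := fun a => Or.inl (s.refl a)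
      symm := by
        intro a b h
        have h2 : ∀ {u v : D}, s u v → s v u := fun p => s.symm p
        grind
      trans := by
        intro a b c h h'
        have h1 : ∀ {u v w : D}, s u v → s v w → s u w := fun p q => s.trans p q
        have h2 : ∀ {u v : D}, s u v → s v u := fun p => s.symm p
        grind }

theorem Setoid.merge_apply {D : Type*} (s : Setoid D) (y y' a b : D) :
    s.merge y y' a b ↔ s a b ∨ (s a y ∧ s b y') ∨ (s a y' ∧ s b y) ∨ (s a y ∧ s b y) ∨
      (s a y' ∧ s b y') := Iff.rfl

theorem Setoid.le_merge {D : Type*} (s : Setoid D) (y y' : D) : s ≤ s.merge y y' :=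
  fun _ _ h => Or.inl h

theorem Setoid.merge_rel {D : Type*} (s : Setoid D) (y y' : D) : s.merge y y' y y' :=
  Or.inr (Or.inl ⟨s.refl y, s.refl y'⟩)

theorem Setoid.merge_le {D : Type*} {s t : Setoid D} {y y' : D} (h : s ≤ t) (hy : t y y') :
    s.merge y y' ≤ t := by
  intro a b hab
  have h1 : ∀ {u v w : D}, t u v → t v w → t u w := fun p q => t.trans p q
  have h2 : ∀ {u v : D}, t u v → t v u := fun p => t.symm p
  have h3 : ∀ {u v : D}, s u v → t u v := fun p => h p
  change s.merge y y' a b at hab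
  rw [Setoid.merge_apply] at hab
  change t a b
  grind

theorem Setoid.merge_eq_self {D : Type*} {s : Setoid D} {y y' : D} (hy : s y y') :
    s.merge y y' = s :=
  le_antisymm (Setoid.merge_le le_rfl hy) (s.le_merge y y')

/-- Discarding the class of `y'` leaves exactly one old class inside each merged class, whence a
bijection. -/
theorem Setoid.card_quotient_merge {D : Type*} [Finite D] (s : Setoid D) (y y' : D)
    (h : ¬ s y y') : Nat.card (Quotient s) = Nat.card (Quotient (s.merge y y')) + 1 := by
  classical
  have : Fintype (Quotient s) := Fintype.ofFinite _
  have e : {q : Quotient s // q ≠ Quotient.mk s y'} ≃ Quotient (s.merge y y') := by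
    refine Equiv.ofBijective (fun q => Quotient.map' id (fun a b hab => s.le_merge y y' hab) q.1)
      ⟨?_, ?_⟩
    · rintro ⟨p, hp⟩ ⟨q, hq⟩ hpq
      induction p using Quotient.inductionOn with | _ a =>
      induction q using Quotient.inductionOn with | _ b =>
      have ha : ¬ s a y' := fun h => hp (Quotient.sound h)
      have hb : ¬ s b y' := fun h => hq (Quotient.sound h)
      have hab : s.merge y y' a b := Quotient.exact hpq
      rw [Setoid.merge_apply] at hab
      refine Subtype.ext (Quotient.sound ?_)
      change s a b
      have h1 : ∀ {u v w : D}, s u v → s v w → s u w := fun p q => s.trans p q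
      have h2 : ∀ {u v : D}, s u v → s v u := fun p => s.symm p
      grind
    · intro q
      induction q using Quotient.inductionOn with | _ a =>
      by_cases ha : s a y'
      · refine ⟨⟨Quotient.mk s y, fun h' => h (Quotient.exact h')⟩, Quotient.sound ?_⟩
        exact Or.inr (Or.inl ⟨s.refl y, ha⟩)
      · exact ⟨⟨Quotient.mk s a, fun h' => ha (Quotient.exact h')⟩, rfl⟩
  rw [← Nat.card_congr e, Nat.card_eq_fintype_card, Nat.card_eq_fintype_card,
    Fintype.card_subtype_compl, Fintype.card_subtype_eq]
  have : 0 < Fintype.card (Quotient s) := Fintype.card_pos_iff.2 ⟨Quotient.mk s y⟩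
  omega

/-! ### Cycles of a permutation composed with a transposition. -/

namespace Equiv.Perm

variable {D : Type*}

/-- Being in the same cycle is the least equivalence relating each `z` to `σ z`; comparisons of
cycle relations are reduced to single steps in this way. -/
theorem sameCycle_setoid_le {σ : Perm D} {t : Setoid D} (h : ∀ z, t z (σ z)) :
    SameCycle.setoid σ ≤ t := by
  rintro a _ ⟨i, rfl⟩
  induction i with
  | zero => exact t.refl a
  | succ i ih =>
    rw [add_comm, zpow_add, zpow_one, mul_apply]
    exact t.trans ih (h _)
  | pred i ih =>
    refine t.trans ih (t.symm ?_)
    have := h ((σ ^ (-(i : ℤ) - 1)) a)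
    rwa [← mul_apply, ← zpow_one_add, show (1 : ℤ) + (-(i : ℤ) - 1) = -i by ring] at this

theorem sameCycle_setoid_inv (σ : Perm D) : SameCycle.setoid σ⁻¹ = SameCycle.setoid σ :=
  Setoid.ext fun _ _ => sameCycle_inv

/-- The number of cycles of a permutation, fixed points included. -/
noncomputable def numCycles (σ : Perm D) : ℕ := Nat.card (Quotient (SameCycle.setoid σ))

variable [DecidableEq D]

theorem sameCycle_setoid_swap_mul_le (σ : Perm D) (y y' : D) :
    SameCycle.setoid (swap y y' * σ) ≤ (SameCycle.setoid σ).merge y y' := by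
  apply sameCycle_setoid_le
  intro z
  have hz : (SameCycle.setoid σ).merge y y' z (σ z) :=
    Or.inl (sameCycle_apply_right.2 (SameCycle.refl σ z))
  have hy := (SameCycle.setoid σ).merge_rel y y'
  rw [mul_apply, swap_apply_def]
  split_ifs with h1 h2
  · rw [h1] at hz; exact Setoid.trans' _ hz hy
  · rw [h2] at hz; exact Setoid.trans' _ hz (Setoid.symm' _ hy)
  · exact hz

/-- Composing twice with the transposition gives back `σ`, so the one-sided bound applies in both
directions. -/
theorem merge_sameCycle_setoid_swap_mul (σ : Perm D) (y y' : D) :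
    (SameCycle.setoid (swap y y' * σ)).merge y y' = (SameCycle.setoid σ).merge y y' := by
  refine le_antisymm (Setoid.merge_le (sameCycle_setoid_swap_mul_le σ y y')
    (Setoid.merge_rel _ y y')) (Setoid.merge_le ?_ (Setoid.merge_rel _ y y'))
  have := sameCycle_setoid_swap_mul_le (swap y y' * σ) y y'
  rwa [swap_mul_self_mul] at this

/-- The cycle of `y` under `σ` avoids `y'`, so the new permutation follows it unchanged up to `σ⁻¹
y`, and from there it jumps to `y'` instead of returning to `y`. -/
theorem sameCycle_swap_mul_of_not_sameCycle [Finite D] {σ : Perm D} {y y' : D}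
    (h : ¬ SameCycle σ y y') : SameCycle (swap y y' * σ) y y' := by
  have key : ∀ i : ℕ, SameCycle (swap y y' * σ) y ((σ ^ i) y) ∨
      SameCycle (swap y y' * σ) y y' := by
    intro i
    induction i with
    | zero => exact Or.inl (SameCycle.refl _ _)
    | succ i ih =>
      refine ih.imp_left fun ih => ?_
      have hne : σ ((σ ^ i) y) ≠ y' := fun e => h ⟨i + 1, by
        rw [add_comm, zpow_add, zpow_one, mul_apply, zpow_natCast, e]⟩
      rw [pow_succ', mul_apply]
      by_cases hy : σ ((σ ^ i) y) = y
      · rw [hy]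
      · have : (swap y y' * σ) ((σ ^ i) y) = σ ((σ ^ i) y) := by
          rw [mul_apply, swap_apply_of_ne_of_ne hy hne]
        rw [← this]
        exact sameCycle_apply_right.2 ih
  obtain ⟨i, -, hi⟩ := (show SameCycle σ y (σ⁻¹ y) from ⟨-1, by rw [zpow_neg_one]⟩).exists_pow_eq'
  rcases key i with h' | h'
  · rw [hi] at h'
    have h'' := sameCycle_apply_right.2 h'
    rwa [mul_apply, show σ (σ⁻¹ y) = y from σ.apply_symm_apply y, swap_apply_left] at h''
  · exact h'

/-- Let `k` be the first time at which `σ` leads from `y` to `y'`. The new permutation returns to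
`y` instead of making the `k`-th step, so its orbit of `y` stays among the first `k` iterates and
misses `y'`. -/
theorem not_sameCycle_swap_mul_of_sameCycle [Finite D] {σ : Perm D} {y y' : D} (hne : y ≠ y')
    (h : SameCycle σ y y') : ¬ SameCycle (swap y y' * σ) y y' := by
  have hex : ∃ k, (σ ^ k) y = y' := by
    obtain ⟨k, -, hk⟩ := h.exists_pow_eq'
    exact ⟨k, hk⟩
  classical
  set k := Nat.find hex with hk
  have hky : (σ ^ k) y = y' := Nat.find_spec hex
  have hmin : ∀ i < k, (σ ^ i) y ≠ y' := fun i hi => Nat.find_min hex hi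
  have key : ∀ n : ℕ, ∃ i < k, ((swap y y' * σ) ^ n) y = (σ ^ i) y := by
    intro n
    have hk0 : 0 < k := Nat.pos_of_ne_zero fun h0 => hne (by rwa [h0, pow_zero] at hky)
    induction n with
    | zero => exact ⟨0, hk0, rfl⟩
    | succ n ih =>
      obtain ⟨i, hi, e⟩ := ih
      rw [pow_succ', mul_apply, e, mul_apply,
        show σ ((σ ^ i) y) = (σ ^ (i + 1)) y by rw [pow_succ', mul_apply]]
      by_cases h1 : (σ ^ (i + 1)) y = y'
      · exact ⟨0, hk0, by rw [h1, swap_apply_right, pow_zero, one_apply]⟩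
      · have h2 : i + 1 < k := lt_of_le_of_ne hi fun e' => h1 (e' ▸ hky)
        -- An earlier return to `y` would let `σ` reach `y'` in `k - (i + 1)` steps, against the
        -- minimality of `k`.
        have h3 : (σ ^ (i + 1)) y ≠ y := fun e' => by
          refine hmin (k - (i + 1)) (by omega) ?_
          have : (σ ^ (k - (i + 1))) ((σ ^ (i + 1)) y) = y' := by
            rw [← mul_apply, ← pow_add, Nat.sub_add_cancel h2.le, hky]
          rwa [e'] at this
        exact ⟨i + 1, h2, by rw [swap_apply_of_ne_of_ne h3 h1]⟩
  intro h'
  obtain ⟨n, -, hn⟩ := h'.exists_pow_eq'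
  obtain ⟨i, hi, e⟩ := key n
  exact hmin i hi (e ▸ hn)

theorem numCycles_swap_mul_of_not_sameCycle [Finite D] {σ : Perm D} {y y' : D}
    (h : ¬ SameCycle σ y y') : σ.numCycles = (swap y y' * σ).numCycles + 1 := by
  rw [numCycles, numCycles, Setoid.card_quotient_merge _ y y' h,
    ← merge_sameCycle_setoid_swap_mul,
    Setoid.merge_eq_self (sameCycle_swap_mul_of_not_sameCycle h)]

theorem numCycles_swap_mul_of_sameCycle [Finite D] {σ : Perm D} {y y' : D} (hne : y ≠ y')
    (h : SameCycle σ y y') : (swap y y' * σ).numCycles = σ.numCycles + 1 := by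
  have := numCycles_swap_mul_of_not_sameCycle (not_sameCycle_swap_mul_of_sameCycle hne h)
  rwa [swap_mul_self_mul] at this

end Equiv.Perm

/-! ### Orbits as classes of equivalences, and the counts as cardinals of quotients. -/

theorem mem_dartOrbit_singleton {D : Type*} [Finite D] (σ : Equiv.Perm D) (x y : D) :
    y ∈ dartOrbit {⇑σ} x ↔ σ.SameCycle x y := by
  constructor
  · intro h
    induction h with
    | refl => exact .refl _ _
    | tail _ h ih =>
      obtain ⟨f, rfl, rfl⟩ := h
      exact Equiv.Perm.sameCycle_apply_right.2 ih
  · intro h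
    obtain ⟨i, -, rfl⟩ := h.exists_pow_eq'
    clear h
    induction i with
    | zero => exact .refl
    | succ i ih => exact ih.tail ⟨σ, rfl, by rw [pow_succ']; rfl⟩

namespace Hypermap

open Equiv Equiv.Perm

variable {D : Type*}

/-- The relation of being in the same component. -/
def componentSetoid (M : Hypermap D) : Setoid D :=
  SameCycle.setoid M.α₀ ⊔ SameCycle.setoid M.α₁

theorem mem_component [Finite D] (M : Hypermap D) (x y : D) :
    y ∈ M.component x ↔ M.componentSetoid x y := by
  constructor
  · intro h
    induction h with
    | refl => exact Setoid.refl' _ _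
    | tail _ h ih =>
      obtain ⟨f, hf | hf, rfl⟩ := h
      · subst hf
        exact Setoid.trans' _ ih ((le_sup_left : _ ≤ M.componentSetoid)
          (sameCycle_apply_right.2 (.refl _ _)))
      · subst hf
        exact Setoid.trans' _ ih ((le_sup_right : _ ≤ M.componentSetoid)
          (sameCycle_apply_right.2 (.refl _ _)))
  · have mono : ∀ (σ : Perm D), ⇑σ ∈ ({⇑M.α₀, ⇑M.α₁} : Set (D → D)) → ∀ u v,
        σ.SameCycle u v → v ∈ M.component u := by
      intro σ hσ u v h
      rw [← mem_dartOrbit_singleton] at h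
      refine Relation.ReflTransGen.mono
        (r := fun a b => ∃ f ∈ ({⇑σ} : Set (D → D)), f a = b) ?_ _ _ h
      rintro a b ⟨f, rfl, e⟩
      exact ⟨_, hσ, e⟩
    intro h
    rw [componentSetoid, Setoid.sup_eq_eqvGen] at h
    change Relation.EqvGen _ x y at h
    -- Accessibility is directed, so both directions are carried along to make the symmetry case of
    -- the induction immediate.
    have key : y ∈ M.component x ∧ x ∈ M.component y := by
      induction h with
      | rel u v h =>
        rcases h with h | h
        · exact ⟨mono _ (by simp) _ _ h, mono _ (by simp) _ _ (SameCycle.symm h)⟩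
        · exact ⟨mono _ (by simp) _ _ h, mono _ (by simp) _ _ (SameCycle.symm h)⟩
      | refl => exact ⟨.refl, .refl⟩
      | symm _ _ _ ih => exact ih.symm
      | trans _ _ _ _ _ ih ih' => exact ⟨ih.1.trans ih'.1, ih'.2.trans ih.2⟩
    exact key.1

section Counting

variable [Finite D] (M : Hypermap D)

theorem mem_edge {x y : D} : y ∈ M.edge x ↔ M.α₀.SameCycle x y := mem_dartOrbit_singleton _ _ _

theorem mem_face {x y : D} : y ∈ M.face x ↔ M.φ.SameCycle x y := mem_dartOrbit_singleton _ _ _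

theorem dartOrbit_singleton_eq_iff (σ : Perm D) (x y : D) :
    dartOrbit {⇑σ} x = dartOrbit {⇑σ} y ↔ SameCycle.setoid σ x y := by
  simp only [Set.ext_iff, mem_dartOrbit_singleton]
  exact ⟨fun h => (h y).2 (.refl _ _), fun h z => ⟨fun h' => (SameCycle.symm h).trans h',
    fun h' => SameCycle.trans h h'⟩⟩

theorem edge_eq_iff {x y : D} : M.edge x = M.edge y ↔ M.α₀.SameCycle x y :=
  dartOrbit_singleton_eq_iff _ _ _

theorem face_eq_iff {x y : D} : M.face x = M.face y ↔ M.φ.SameCycle x y :=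
  dartOrbit_singleton_eq_iff _ _ _

theorem numEdges_eq : M.numEdges = M.α₀.numCycles :=
  Setoid.ncard_range_eq_card_quotient _ _ (dartOrbit_singleton_eq_iff M.α₀)

theorem numVertices_eq : M.numVertices = M.α₁.numCycles :=
  Setoid.ncard_range_eq_card_quotient _ _ (dartOrbit_singleton_eq_iff M.α₁)

theorem numFaces_eq : M.numFaces = M.φ.numCycles :=
  Setoid.ncard_range_eq_card_quotient _ _ (dartOrbit_singleton_eq_iff M.φ)

theorem numComponents_eq : M.numComponents = Nat.card (Quotient M.componentSetoid) := by
  refine Setoid.ncard_range_eq_card_quotient _ _ fun x y => ?_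
  simp only [Set.ext_iff, mem_component]
  exact ⟨fun h => (h y).2 (Setoid.refl' _ _), fun h z =>
    ⟨fun h' => Setoid.trans' _ (Setoid.symm' _ h) h', fun h' => Setoid.trans' _ h h'⟩⟩

end Counting

end Hypermap

/-! ### Effect of one break on edges, faces and components. -/

namespace Hypermap

open Equiv Equiv.Perm

variable {D : Type*}

section Break

variable (M : Hypermap D) (y y' : D)

theorem breakLink_α₀ [DecidableEq D] : (M.breakLink (y, y')).α₀ = swap y y' * M.α₀ := by
  ext z
  rw [breakLink, Perm.mul_apply, Equiv.trans_apply]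
  congr!

/-- The inverse of `φ` is `α₀ * α₁`, with `α₀` on the left. Working with `φ⁻¹` lets the same cycle
counts serve for faces as for edges. -/
theorem breakLink_φ_inv [DecidableEq D] : (M.breakLink (y, y')).φ⁻¹ = swap y y' * M.φ⁻¹ := by
  rw [φ, φ, breakLink_α₀, breakLink]
  simp [mul_assoc]

/-- Breaking the same pair twice restores `M`, so an inequality valid for every hypermap yields the
equality. -/
theorem merge_componentSetoid_breakLink :
    (M.breakLink (y, y')).componentSetoid.merge y y' = M.componentSetoid.merge y y' := by
  classical
  have key : ∀ N : Hypermap D, (N.breakLink (y, y')).componentSetoid.merge y y' ≤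
      N.componentSetoid.merge y y' := by
    intro N
    refine Setoid.merge_le (sup_le ?_ ?_) (Setoid.merge_rel _ _ _)
    · rw [breakLink_α₀]
      refine (sameCycle_setoid_swap_mul_le _ _ _).trans (Setoid.merge_le ?_ (Setoid.merge_rel _ _ _))
      exact le_sup_left.trans (Setoid.le_merge _ _ _)
    · exact (le_sup_right : _ ≤ N.componentSetoid).trans (Setoid.le_merge _ _ _)
  have hM : (M.breakLink (y, y')).breakLink (y, y') = M := by
    have h0 : ((M.breakLink (y, y')).breakLink (y, y')).α₀ = M.α₀ := by
      rw [breakLink_α₀, breakLink_α₀, swap_mul_self_mul]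
    cases M
    simp only [breakLink, mk.injEq, and_true] at h0 ⊢
    exact h0
  refine le_antisymm (key M) ?_
  have := key (M.breakLink (y, y'))
  rwa [hM] at this

theorem sameCycle_φ_le_componentSetoid : SameCycle.setoid M.φ ≤ M.componentSetoid := by
  apply sameCycle_setoid_le
  intro z
  have h0 : M.componentSetoid z (M.α₀⁻¹ z) := (le_sup_left : _ ≤ M.componentSetoid)
    (show SameCycle _ _ _ from ⟨-1, by rw [zpow_neg_one]⟩)
  exact Setoid.trans' _ h0 ((le_sup_right : _ ≤ M.componentSetoid)
    (show SameCycle _ _ _ from ⟨-1, by rw [zpow_neg_one]; rfl⟩))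

variable {M y y'}

theorem merge_componentSetoid_breakLink_of_sameCycle (he : M.α₀.SameCycle y y') :
    (M.breakLink (y, y')).componentSetoid.merge y y' = M.componentSetoid := by
  rw [merge_componentSetoid_breakLink, Setoid.merge_eq_self]
  exact (le_sup_left : _ ≤ M.componentSetoid) he

variable [Finite D]

theorem numEdges_breakLink (hne : y ≠ y') (he : M.α₀.SameCycle y y') :
    (M.breakLink (y, y')).numEdges = M.numEdges + 1 := by
  classical
  rw [numEdges_eq, numEdges_eq, breakLink_α₀, numCycles_swap_mul_of_sameCycle hne he]

theorem numFaces_eq_inv (M : Hypermap D) : M.numFaces = M.φ⁻¹.numCycles := by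
  rw [numFaces_eq, numCycles, numCycles, sameCycle_setoid_inv]

theorem numFaces_breakLink_of_sameCycle (hne : y ≠ y') (h : M.φ.SameCycle y y') :
    (M.breakLink (y, y')).numFaces = M.numFaces + 1 := by
  classical
  rw [numFaces_eq_inv, numFaces_eq_inv, breakLink_φ_inv,
    numCycles_swap_mul_of_sameCycle hne (sameCycle_inv.2 h)]

theorem numFaces_breakLink_of_not_sameCycle (h : ¬ M.φ.SameCycle y y') :
    M.numFaces = (M.breakLink (y, y')).numFaces + 1 := by
  classical
  rw [numFaces_eq_inv, numFaces_eq_inv, breakLink_φ_inv]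
  exact numCycles_swap_mul_of_not_sameCycle (fun h' => h (sameCycle_inv.1 h'))

theorem sameCycle_setoid_φ_breakLink_of_not_sameCycle (h : ¬ M.φ.SameCycle y y') :
    SameCycle.setoid (M.breakLink (y, y')).φ = (SameCycle.setoid M.φ).merge y y' := by
  classical
  rw [← sameCycle_setoid_inv, breakLink_φ_inv, ← sameCycle_setoid_inv M.φ,
    ← merge_sameCycle_setoid_swap_mul, Setoid.merge_eq_self]
  exact sameCycle_swap_mul_of_not_sameCycle (fun h' => h (sameCycle_inv.1 h'))

/-- The two darts are in one component of `M`, so the components of `M` are those of the break with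
the classes of `y` and `y'` merged. -/
theorem numComponents_breakLink_le (he : M.α₀.SameCycle y y') :
    (M.breakLink (y, y')).numComponents ≤ M.numComponents + 1 := by
  rw [numComponents_eq, numComponents_eq, ← merge_componentSetoid_breakLink_of_sameCycle he]
  by_cases h : (M.breakLink (y, y')).componentSetoid y y'
  · rw [Setoid.merge_eq_self h]
    exact Nat.le_succ _
  · rw [← Setoid.card_quotient_merge _ _ _ h]

/-- Breaking a link between two different faces does not change the components: the merged face
of the break joins the two darts. -/
theorem numComponents_breakLink_of_not_sameCycle (he : M.α₀.SameCycle y y')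
    (h : ¬ M.φ.SameCycle y y') : (M.breakLink (y, y')).numComponents = M.numComponents := by
  have hc : (M.breakLink (y, y')).componentSetoid y y' := by
    apply sameCycle_φ_le_componentSetoid
    rw [sameCycle_setoid_φ_breakLink_of_not_sameCycle h]
    exact Setoid.merge_rel _ _ _
  rw [numComponents_eq, numComponents_eq, ← merge_componentSetoid_breakLink_of_sameCycle he,
    Setoid.merge_eq_self hc]

end Break

/-! ### The genus is a natural number. -/

section Genus

theorem planar_iff {M : Hypermap D} : M.Planar ↔ 2 * (M.numComponents : ℤ) = M.eulerChar := by
  rw [Planar, genus, sub_eq_zero, eq_div_iff two_ne_zero, mul_comm]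
  exact_mod_cast Iff.rfl

variable [Finite D]

/-- The genus theorem: the Euler characteristic is even and at most twice the number of
components. -/
theorem exists_two_mul_numComponents_eq (M : Hypermap D) :
    ∃ g : ℕ, 2 * (M.numComponents : ℤ) = M.eulerChar + 2 * g := by
  -- The induction is on a bound for the number of darts minus the number of edges, which drops with
  -- each break. It ends at `α₀ = 1`, where edges are darts, vertices and faces are both components,
  -- and the genus is 0.
  obtain ⟨n, hn⟩ : ∃ n, Nat.card D ≤ M.numEdges + n := ⟨_, Nat.le_add_left _ _⟩
  induction n generalizing M with
  | zero =>
    have h1 : M.α₀ = 1 := by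
      by_contra h1
      obtain ⟨y, hy⟩ : ∃ y, M.α₀ y ≠ y := by
        by_contra! h
        exact h1 (Equiv.ext h)
      -- A further break would produce more edges than darts.
      have h2 := numEdges_breakLink (M := M) (Ne.symm hy) (sameCycle_apply_right.2 (.refl _ _))
      have h3 : (M.breakLink (y, M.α₀ y)).numEdges ≤ Nat.card D := by
        rw [numEdges_eq]
        exact Nat.card_le_card_of_surjective _ Quotient.mk_surjective
      omega
    have hs0 : SameCycle.setoid M.α₀ = ⊥ := by
      refine le_bot_iff.1 (sameCycle_setoid_le fun z => ?_)
      rw [h1]; rfl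
    have he : M.numEdges = Nat.card D := by
      refine le_antisymm ?_ (by omega)
      rw [numEdges_eq]
      exact Nat.card_le_card_of_surjective _ Quotient.mk_surjective
    have hf : M.numFaces = M.numComponents := by
      rw [numFaces_eq, numComponents_eq, componentSetoid, hs0, bot_sup_eq, numCycles, φ, h1,
        inv_one, mul_one, sameCycle_setoid_inv]
    have hv : M.numVertices = M.numComponents := by
      rw [numVertices_eq, numComponents_eq, componentSetoid, hs0, bot_sup_eq, numCycles]
    refine ⟨0, ?_⟩
    rw [eulerChar, hf, hv, he, numDarts]
    push_cast
    ring
  | succ n ih =>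
    by_cases h1 : M.α₀ = 1
    · refine ih M ?_
      have : M.numEdges = Nat.card D := by
        rw [numEdges_eq]
        refine (Nat.card_congr (Equiv.ofBijective _ ⟨?_, Quotient.mk_surjective⟩)).symm
        intro a b hab
        obtain ⟨i, hi⟩ := Quotient.exact hab
        simpa [h1] using hi
      omega
    · obtain ⟨y, hy⟩ : ∃ y, M.α₀ y ≠ y := by
        by_contra! h
        exact h1 (Equiv.ext h)
      have he : M.α₀.SameCycle y (M.α₀ y) := sameCycle_apply_right.2 (.refl _ _)
      have h2 := numEdges_breakLink (Ne.symm hy) he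
      obtain ⟨g, hg⟩ := ih (M.breakLink (y, M.α₀ y)) (by omega)
      have h3 : (M.breakLink (y, M.α₀ y)).numVertices = M.numVertices := rfl
      have h4 : (M.breakLink (y, M.α₀ y)).numDarts = M.numDarts := rfl
      unfold eulerChar at hg ⊢
      by_cases hf : M.φ.SameCycle y (M.α₀ y)
      · have h5 := numFaces_breakLink_of_sameCycle (Ne.symm hy) hf
        have h6 := numComponents_breakLink_le he
        -- Here `χ` grows by 2, so the genus of `M` is `g` plus 1 minus the number of new
        -- components. The natural subtraction is exact by `h6`.
        exact ⟨M.numComponents + 1 + g - (M.breakLink (y, M.α₀ y)).numComponents, by omega⟩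
      · have h5 := numFaces_breakLink_of_not_sameCycle hf
        have h6 := numComponents_breakLink_of_not_sameCycle he hf
        exact ⟨g, by omega⟩

end Genus

/-! ### Rings of faces under a break, and the Jordan theorem for hypermaps. -/

section Ring

variable {M : Hypermap D}

/-- Only the edge of `y` is altered: the old and new edge relations agree after merging `y` and
`y'`, and `a` is related to neither. -/
theorem sameCycle_α₀_breakLink {y y' a b : D} (h : M.α₀.SameCycle y y')
    (ha : ¬ M.α₀.SameCycle y a) (hab : M.α₀.SameCycle a b) :
    (M.breakLink (y, y')).α₀.SameCycle a b := by
  classical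
  have h' := (SameCycle.setoid M.α₀).le_merge y y' hab
  rw [← merge_sameCycle_setoid_swap_mul, ← breakLink_α₀, Setoid.merge_apply] at h'
  have hle : ∀ u v, (M.breakLink (y, y')).α₀.SameCycle u v → M.α₀.SameCycle u v := by
    intro u v huv
    have := sameCycle_setoid_swap_mul_le M.α₀ y y'
    rw [Setoid.merge_eq_self h, ← breakLink_α₀] at this
    exact this huv
  have h1 : ¬ (M.breakLink (y, y')).α₀.SameCycle a y := fun e => ha (hle _ _ e).symm
  have h2 : ¬ (M.breakLink (y, y')).α₀.SameCycle a y' := fun e => ha (h.trans (hle _ _ e).symm)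
  change (M.breakLink (y, y')).α₀.SameCycle a b ∨ ((M.breakLink (y, y')).α₀.SameCycle a y ∧ _) ∨
    ((M.breakLink (y, y')).α₀.SameCycle a y' ∧ _) ∨
    ((M.breakLink (y, y')).α₀.SameCycle a y ∧ _) ∨
    ((M.breakLink (y, y')).α₀.SameCycle a y' ∧ _) at h'
  tauto

theorem sameCycle_α₀_of_breakLink {y y' a b : D} (h : M.α₀.SameCycle y y')
    (hab : (M.breakLink (y, y')).α₀.SameCycle a b) : M.α₀.SameCycle a b := by
  classical
  have := sameCycle_setoid_swap_mul_le M.α₀ y y'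
  rw [Setoid.merge_eq_self h, ← breakLink_α₀] at this
  exact this hab

variable [Finite D]

/-- Breaking the first link of a ring of at least two faces leaves a ring. -/
theorem IsRing.breakLink {p q : D × D} {R : List (D × D)} (h : M.IsRing (p :: q :: R)) :
    (M.breakLink p).IsRing (q :: R) := by
  obtain ⟨y, y'⟩ := p
  have hy := (h.doubleLink _ List.mem_cons_self).2
  rw [mem_edge] at hy
  obtain ⟨hu, hu'⟩ := List.pairwise_cons.1 h.unicity
  obtain ⟨hs, hs'⟩ := List.pairwise_cons.1 h.simplicity
  obtain ⟨⟨-, hc⟩, hc'⟩ := List.isChain_cons_cons.1 h.continuity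
  simp only [mem_face] at hc
  -- By continuity `y'` lies in the second face, which simplicity separates from the first.
  have hyy : ¬ M.φ.SameCycle y y' := fun e =>
    hs q List.mem_cons_self ((M.face_eq_iff).2 (e.trans hc.symm))
  have hφ : ∀ a b, (M.breakLink (y, y')).φ.SameCycle a b ↔
      (SameCycle.setoid M.φ).merge y y' a b := fun a b => by
    rw [← sameCycle_setoid_φ_breakLink_of_not_sameCycle hyy]; rfl
  have hmono : ∀ a b, b ∈ M.face a → b ∈ (M.breakLink (y, y')).face a := fun a b hab => by
    rw [mem_face, hφ]
    exact Or.inl ((mem_face _).1 hab)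
  have hcirc := h.circularity
  rw [List.getLast_cons (List.cons_ne_nil q R)] at hcirc
  refine ⟨List.cons_ne_nil _ _, ?_, ?_, ?_, ⟨?_, ?_⟩, ?_⟩
  · intro r hr
    obtain ⟨h1, h2⟩ := h.doubleLink r (List.mem_cons_of_mem _ hr)
    rw [mem_edge] at h2
    refine ⟨h1, (mem_edge _).2 (sameCycle_α₀_breakLink hy ?_ h2)⟩
    exact fun e => hu r hr ((edge_eq_iff _).2 e)
  · refine hu'.imp fun {a b} hab e => hab ?_
    rw [edge_eq_iff] at e ⊢
    exact sameCycle_α₀_of_breakLink hy e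
  · exact hc'.imp fun a b hab => ⟨hmono _ _ hab.1, hmono _ _ hab.2⟩
  · exact hmono _ _ hcirc.1
  · have h1 := hcirc.2
    simp only [List.head_cons] at h1 ⊢
    rw [mem_face] at h1
    rw [mem_face, hφ]
    -- The last link leads into the old first face, which is now merged with the second, the new
    -- first one.
    exact Or.inr (Or.inr (Or.inl ⟨hc, h1.symm⟩))
  · have hns : ∀ r ∈ q :: R, ¬ M.φ.SameCycle r.1 y := fun r hr e =>
      hs r hr ((face_eq_iff _).2 e.symm)
    -- No remaining face is the first one, so two of them can become equal only if both were already
    -- the face of `y'`.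
    refine (List.Pairwise.and_mem.1 hs').imp fun {a b} ⟨ha, hb, hab⟩ e => hab ?_
    rw [face_eq_iff, hφ, Setoid.merge_apply] at e
    rw [face_eq_iff]
    rcases e with e | ⟨e, -⟩ | ⟨-, e⟩ | ⟨e, -⟩ | ⟨e, e'⟩
    · exact e
    · exact absurd e (hns a ha)
    · exact absurd e (hns b hb)
    · exact absurd e (hns a ha)
    · exact SameCycle.trans e (SameCycle.symm e')

/-- The discrete Jordan curve theorem for hypermaps. -/
theorem numComponents_breakAlong (R : List (D × D)) (M : Hypermap D) (hM : M.Planar)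
    (hR : M.IsRing R) : (M.breakAlong R).numComponents = M.numComponents + 1 := by
  induction R generalizing M with
  | nil => exact absurd rfl hR.nonempty
  | cons p R ih =>
    obtain ⟨y, y'⟩ := p
    have hne : y ≠ y' := (hR.doubleLink _ List.mem_cons_self).1
    have he : M.α₀.SameCycle y y' := (mem_edge _).1 (hR.doubleLink _ List.mem_cons_self).2
    rw [planar_iff] at hM
    have h2 := numEdges_breakLink hne he
    have h3 : (M.breakLink (y, y')).numVertices = M.numVertices := rfl
    have h4 : (M.breakLink (y, y')).numDarts = M.numDarts := rfl
    cases R with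
    | nil =>
      have hf : M.φ.SameCycle y y' := (mem_face _).1 hR.circularity.2
      have h5 := numFaces_breakLink_of_sameCycle hne hf
      have h6 := numComponents_breakLink_le he
      -- Planarity of `M` makes `χ` of the break equal to `2c + 2`. Non-negative genus then forces
      -- at least `c + 1` components, and `h6` allows no more.
      obtain ⟨g, hg⟩ := exists_two_mul_numComponents_eq (M.breakLink (y, y'))
      change (M.breakLink (y, y')).numComponents = _
      unfold eulerChar at hg hM
      omega
    | cons q R =>
      have hf : ¬ M.φ.SameCycle y y' := fun e => by
        have hs := (List.pairwise_cons.1 hR.simplicity).1 q List.mem_cons_self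
        have hc := (List.isChain_cons_cons.1 hR.continuity).1.2
        rw [mem_face] at hc
        exact hs ((face_eq_iff _).2 (e.trans hc.symm))
      have h5 := numFaces_breakLink_of_not_sameCycle hf
      have h6 := numComponents_breakLink_of_not_sameCycle he hf
      rw [← h6]
      refine ih _ ?_ hR.breakLink
      rw [planar_iff]
      unfold eulerChar at hM ⊢
      omega

end Ring

end Hypermap

/-! ### Open orbits of free maps and their closures. -/

namespace FMap

theorem ne_nilDart_of_exd {m : FMap} {z : Dart} (h : inv_hmap m) (hz : exd m z) :
    z ≠ nilDart := by
  induction m with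
  | V => exact hz.elim
  | I m x ih =>
    rcases hz with rfl | hz
    · exact h.2.1
    · exact ih h.1 hz
  | L m k x y ih => exact ih h.1 hz

theorem exd_of_succ {m : FMap} {k : Dim} {z : Dart} (h : inv_hmap m) (hz : succ m k z) :
    exd m z ∧ exd m (A m k z) := by
  induction m with
  | V => exact absurd rfl hz
  | I m x ih => exact ⟨Or.inr (ih h.1 hz).1, Or.inr (ih h.1 hz).2⟩
  | L m k₀ x y ih =>
    obtain ⟨h, hx, hy, -⟩ := h
    simp only [succ, A, exd] at hz ih ⊢
    split_ifs at hz ⊢ with h1 h2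
    · subst h2
      exact ⟨hx, hy⟩
    · exact ih h hz
    · exact ih h hz

theorem exd_of_pred {m : FMap} {k : Dim} {z : Dart} (h : inv_hmap m) (hz : pred m k z) :
    exd m z ∧ exd m (A_1 m k z) := by
  induction m with
  | V => exact absurd rfl hz
  | I m x ih => exact ⟨Or.inr (ih h.1 hz).1, Or.inr (ih h.1 hz).2⟩
  | L m k₀ x y ih =>
    obtain ⟨h, hx, hy, -⟩ := h
    simp only [pred, A_1, exd] at hz ih ⊢
    split_ifs at hz ⊢ with h1 h2
    · subst h2
      exact ⟨hy, hx⟩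
    · exact ih h hz
    · exact ih h hz

theorem A_1_A {m : FMap} {k : Dim} {z : Dart} (h : inv_hmap m) (hz : succ m k z) :
    A_1 m k (A m k z) = z := by
  induction m with
  | V => exact absurd rfl hz
  | I m x ih => exact ih h.1 hz
  | L m k₀ x y ih =>
    obtain ⟨h, hx, hy, hsx, hpy, -⟩ := h
    have h1 := fun hs => ne_nilDart_of_exd h (exd_of_succ (k := k) (z := z) h hs).1
    simp only [succ, pred, A, A_1, not_not] at *
    grind

theorem A_A_1 {m : FMap} {k : Dim} {z : Dart} (h : inv_hmap m) (hz : pred m k z) :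
    A m k (A_1 m k z) = z := by
  induction m with
  | V => exact absurd rfl hz
  | I m x ih => exact ih h.1 hz
  | L m k₀ x y ih =>
    obtain ⟨h, hx, hy, hsx, hpy, -⟩ := h
    have h1 := fun hs => ne_nilDart_of_exd h (exd_of_pred (k := k) (z := z) h hs).1
    simp only [succ, pred, A, A_1, not_not] at *
    grind

theorem exd_bottom {m : FMap} {k : Dim} {z : Dart} (h : inv_hmap m) (hz : exd m z) :
    exd m (bottom m k z) := by
  induction m generalizing z with
  | V => exact hz.elim
  | I m x ih =>
    simp only [bottom, exd] at hz ⊢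
    split_ifs with h1
    · exact Or.inl rfl
    · exact Or.inr (ih h.1 (hz.resolve_left h1))
  | L m k₀ x y ih =>
    simp only [bottom, exd] at hz ⊢
    have h1 := ih h.1 hz
    have h2 := ih h.1 h.2.1
    split_ifs <;> assumption

theorem exd_top {m : FMap} {k : Dim} {z : Dart} (h : inv_hmap m) (hz : exd m z) :
    exd m (top m k z) := by
  induction m generalizing z with
  | V => exact hz.elim
  | I m x ih =>
    simp only [top, exd] at hz ⊢
    split_ifs with h1
    · exact Or.inl rfl
    · exact Or.inr (ih h.1 (hz.resolve_left h1))
  | L m k₀ x y ih =>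
    simp only [top, exd] at hz ⊢
    have h1 := ih h.1 hz
    have h2 := ih h.1 h.2.2.1
    split_ifs <;> assumption

theorem bottom_eq_self {m : FMap} {k : Dim} {z : Dart} (h : inv_hmap m) (hz : exd m z)
    (hp : A_1 m k z = nilDart) : bottom m k z = z := by
  induction m with
  | V => exact hz.elim
  | I m x ih =>
    simp only [bottom, exd, A_1] at *
    split_ifs with h1
    · exact h1.symm
    · exact ih h.1 (hz.resolve_left h1) hp
  | L m k₀ x y ih =>
    obtain ⟨h, hx, hy, hsx, hpy, -⟩ := h
    have := ne_nilDart_of_exd h hx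
    simp only [bottom, exd, A_1] at *
    grind

/-- The last condition of `prec_L`, for a dart without successor. -/
theorem bottom_ne_of_prec_L {m : FMap} {k : Dim} {x y : Dart} (h : prec_L m k x y) :
    bottom m k x ≠ y := by
  obtain ⟨-, -, hs, -, hc⟩ := h
  rwa [cA, if_pos (not_not.1 hs)] at hc

theorem A_1_bottom {m : FMap} {k : Dim} {z : Dart} (h : inv_hmap m) (hz : exd m z) :
    A_1 m k (bottom m k z) = nilDart := by
  induction m generalizing z with
  | V => exact hz.elim
  | I m x ih =>
    simp only [bottom, exd, A_1] at *
    split_ifs with h1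
    · by_contra hp
      exact h.2.2 (exd_of_pred h.1 hp).1
    · exact ih h.1 (hz.resolve_left h1)
  | L m k₀ x y ih =>
    obtain ⟨h, hp⟩ := h
    have hb := bottom_ne_of_prec_L hp
    obtain ⟨hx, hy, hsx, hpy, -⟩ := hp
    have h1 := ih h hx
    have h2 := ih h hz
    simp only [bottom, A_1] at *
    grind

theorem top_bottom {m : FMap} {k : Dim} {z : Dart} (h : inv_hmap m) (hz : exd m z)
    (hs : A m k z = nilDart) : top m k (bottom m k z) = z := by
  induction m generalizing z with
  | V => exact hz.elim
  | I m x ih =>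
    have hx := h.2.2
    have hb := @exd_bottom m k z h.1
    replace h := h.1
    simp only [bottom, exd, A, top] at *
    grind
  | L m k₀ x y ih =>
    obtain ⟨h, hx, hy, hsx, hpy, -⟩ := h
    have hy0 := ne_nilDart_of_exd h hy
    have h1 := @ih x h hx
    have h2 := @ih z h hz
    simp only [bottom, A, top, succ, not_not] at *
    grind

theorem bottom_top {m : FMap} {k : Dim} {z : Dart} (h : inv_hmap m) (hz : exd m z)
    (hs : A_1 m k z = nilDart) : bottom m k (top m k z) = z := by
  induction m generalizing z with
  | V => exact hz.elim
  | I m x ih =>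
    have hx := h.2.2
    have hb := @exd_top m k z h.1
    replace h := h.1
    simp only [bottom, exd, A_1, top] at *
    grind
  | L m k₀ x y ih =>
    obtain ⟨h, hx, hy, hsx, hpy, -⟩ := h
    have hx0 := ne_nilDart_of_exd h hx
    have h1 := @ih y h hy
    have h2 := @ih z h hz
    simp only [bottom, A_1, top, pred, not_not] at *
    grind

theorem A_top {m : FMap} {k : Dim} {z : Dart} (h : inv_hmap m) (hz : exd m z) :
    A m k (top m k z) = nilDart := by
  have h1 := A_1_bottom (k := k) h hz
  induction m generalizing z with
  | V => exact hz.elim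
  | I m x ih =>
    have hb := @A_1_bottom m k z h.1
    simp only [bottom, top, exd, A, A_1] at *
    split_ifs with h1
    · by_contra hp
      exact h.2.2 (exd_of_succ h.1 hp).1
    · exact ih h.1 (hz.resolve_left h1) (hb (hz.resolve_left h1))
  | L m k₀ x y ih =>
    obtain ⟨h, hp⟩ := h
    have hb := bottom_ne_of_prec_L hp
    obtain ⟨hx, hy, hsx, hpy, -⟩ := hp
    have h1 := ih h hy (A_1_bottom h hy)
    have h2 := ih h hz (A_1_bottom h hz)
    -- If the orbit starting at `y` ended at `x`, then `y` would be the first dart of the orbit of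
    -- `x`, which `prec_L` excludes.
    have h3 : k = k₀ → top m k y ≠ x := by
      rintro rfl e
      exact hb (e ▸ bottom_top h hy (not_not.1 hpy))
    simp only [top, A] at *
    grind

theorem exd_cA {m : FMap} {k : Dim} {z : Dart} (h : inv_hmap m) (hz : exd m z) :
    exd m (cA m k z) := by
  unfold cA
  split_ifs with h1
  · exact exd_bottom h hz
  · exact (exd_of_succ h h1).2

theorem exd_cA_1 {m : FMap} {k : Dim} {z : Dart} (h : inv_hmap m) (hz : exd m z) :
    exd m (cA_1 m k z) := by
  unfold cA_1
  split_ifs with h1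
  · exact exd_top h hz
  · exact (exd_of_pred h h1).2

theorem cA_1_cA {m : FMap} {k : Dim} {z : Dart} (h : inv_hmap m) (hz : exd m z) :
    cA_1 m k (cA m k z) = z := by
  by_cases h1 : A m k z = nilDart
  · rw [cA, if_pos h1, cA_1, if_pos (A_1_bottom h hz), top_bottom h hz h1]
  · rw [cA, if_neg h1, cA_1, A_1_A h h1, if_neg (ne_nilDart_of_exd h hz)]

theorem cA_cA_1 {m : FMap} {k : Dim} {z : Dart} (h : inv_hmap m) (hz : exd m z) :
    cA m k (cA_1 m k z) = z := by
  by_cases h1 : A_1 m k z = nilDart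
  · rw [cA_1, if_pos h1, cA, if_pos (A_top h hz), bottom_top h hz h1]
  · rw [cA_1, if_neg h1, cA, A_A_1 h h1, if_neg (ne_nilDart_of_exd h hz)]

/-- A successor has a predecessor, and the first dart of an open orbit has none. This makes the
coded double-links pairs of different darts. -/
theorem A_ne_bottom {m : FMap} {k : Dim} {x z : Dart} (h : inv_hmap m) (hx : succ m k x)
    (hz : exd m z) : A m k x ≠ bottom m k z := by
  intro e
  have h1 := A_1_bottom (k := k) h hz
  rw [← e, A_1_A h hx] at h1
  exact ne_nilDart_of_exd h (exd_of_succ h hx).1 h1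

/-- Linking `x` to `y` composes the closure with a transposition. -/
theorem cA_L {m : FMap} {k : Dim} {x y z : Dart} (h : inv_hmap m) (hp : prec_L m k x y)
    (hz : exd m z) :
    cA (L m k x y) k z = Equiv.swap y (bottom m k x) (cA m k z) := by
  have hb := bottom_ne_of_prec_L hp
  obtain ⟨hx, hy, hsx, hpy, -⟩ := hp
  have hy0 := ne_nilDart_of_exd h hy
  have h1 := fun hs => A_1_A (m := m) (k := k) (z := z) h hs
  have h2 := fun hs => A_ne_bottom (m := m) (k := k) (x := z) h hs hx
  have h3 := top_bottom (k := k) h hx (not_not.1 hsx)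
  have h4 := fun hs => top_bottom (k := k) h hz hs
  have hz0 := ne_nilDart_of_exd h hz
  -- The link exchanges two images: `x` went to `bottom m k x` and now goes to `y`, while the last
  -- dart of the orbit of `y` went to `y` and now goes to `bottom m k x`.
  simp only [cA, A, bottom, succ, pred, not_not, Equiv.swap_apply_def, if_true] at *
  grind

theorem cA_L_of_ne {m : FMap} {k k₀ : Dim} {x y z : Dart} (hk : k ≠ k₀) :
    cA (L m k₀ x y) k z = cA m k z := by
  simp only [cA, A, bottom, if_neg hk]

/-! ### Breaking a link -/

theorem exd_B {m : FMap} {k : Dim} {x z : Dart} : exd (B m k x) z ↔ exd m z := by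
  induction m with
  | V => rfl
  | I m a ih => exact or_congr_right ih
  | L m k₀ a b ih =>
    simp only [B]
    split_ifs
    · rfl
    · exact ih
    · exact ih

theorem A_B {m : FMap} {k : Dim} {x z : Dart} (h : inv_hmap m) :
    A (B m k x) k z = if z = x then nilDart else A m k z := by
  induction m with
  | V => simp [B, A]
  | I m a ih => exact ih h.1
  | L m k₀ a b ih =>
    obtain ⟨h, hx, hy, hsx, hpy, -⟩ := h
    have := ih h
    simp only [B, A, succ, not_not] at *
    by_cases h1 : k = k₀
    · subst h1
      by_cases h2 : a = x
      · subst h2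
        grind
      · grind [A]
    · grind [A]

theorem A_1_B_eq_nilDart {m : FMap} {k : Dim} {x z : Dart} (hz : A_1 m k z = nilDart)
    (h : inv_hmap m) : A_1 (B m k x) k z = nilDart := by
  induction m with
  | V => exact hz
  | I m a ih => exact ih hz h.1
  | L m k₀ a b ih =>
    have ha := ne_nilDart_of_exd h.1 h.2.1
    have := fun hz => ih hz h.1
    simp only [B, A_1] at *
    by_cases h1 : k = k₀
    · subst h1
      by_cases h2 : a = x
      · subst h2
        grind
      · grind [A_1]
    · grind [A_1]

theorem A_B_of_ne {m : FMap} {k k' : Dim} {x z : Dart} (hk : k' ≠ k) :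
    A (B m k x) k' z = A m k' z := by
  induction m with
  | V => rfl
  | I m a ih => exact ih
  | L m k₀ a b ih =>
    simp only [B]
    grind [A]

theorem A_1_B_of_ne {m : FMap} {k k' : Dim} {x z : Dart} (hk : k' ≠ k) :
    A_1 (B m k x) k' z = A_1 m k' z := by
  induction m with
  | V => rfl
  | I m a ih => exact ih
  | L m k₀ a b ih =>
    simp only [B]
    grind [A_1]

theorem bottom_B_of_ne {m : FMap} {k k' : Dim} {x z : Dart} (hk : k' ≠ k) :
    bottom (B m k x) k' z = bottom m k' z := by
  induction m generalizing z with
  | V => rfl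
  | I m a ih => simp only [B, bottom, ih]
  | L m k₀ a b ih =>
    simp only [B]
    grind [bottom]

theorem cA_B_of_ne {m : FMap} {k k' : Dim} {x z : Dart} (hk : k' ≠ k) :
    cA (B m k x) k' z = cA m k' z := by
  rw [cA, cA, A_B_of_ne hk, bottom_B_of_ne hk]

/-- The two claims need a joint induction: when the deleted link lies below another link from `a` to
`b`, the latter stays legal only if `b` is not the first dart of the orbit of `a` in the broken map,
and this is read off the formula for `cA`. -/
theorem inv_hmap_B_and_cA_B {m : FMap} {k : Dim} {x : Dart} (h : inv_hmap m)
    (hx : succ m k x) : inv_hmap (B m k x) ∧ ∀ z, exd m z →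
      cA (B m k x) k z = Equiv.swap (A m k x) (bottom m k x) (cA m k z) := by
  induction m with
  | V => exact absurd rfl hx
  | I m a ih =>
    obtain ⟨ih1, ih2⟩ := ih h.1 hx
    have hax : x ≠ a := fun e => h.2.2 (e ▸ (exd_of_succ h.1 hx).1)
    refine ⟨⟨ih1, h.2.1, fun e => h.2.2 (exd_B.1 e)⟩, ?_⟩
    rintro z hz
    by_cases hza : z = a
    · subst hza
      have h1 : A m k z = nilDart := by
        by_contra hp
        exact h.2.2 (exd_of_succ h.1 hp).1
      have h2 : A m k x ≠ z := fun e => h.2.2 (e ▸ (exd_of_succ h.1 hx).2)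
      have h3 : bottom m k x ≠ z := fun e => h.2.2 (e ▸ exd_bottom h.1 (exd_of_succ h.1 hx).1)
      simp only [B, cA, A, bottom, A_B h.1, h1, if_neg hax, if_neg hax.symm, if_true]
      rw [Equiv.swap_apply_of_ne_of_ne h2.symm h3.symm]
    · have := ih2 z (hz.resolve_left hza)
      simp only [B, cA, A, bottom, if_neg hza, if_neg hax] at this ⊢
      exact this
  | L m k₀ a b ih =>
    obtain ⟨h, hp⟩ := h
    by_cases hk : k = k₀
    · subst hk
      have hb := bottom_ne_of_prec_L hp
      obtain ⟨ha, hb', hsa, hpb, -⟩ := id hp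
      by_cases hax : a = x
      · subst hax
        simp only [B, if_true]
        refine ⟨h, fun z hz => ?_⟩
        rw [cA_L h hp hz]
        simp [A, bottom, hb]
      · have hx' : succ m k x := by
          simpa [succ, A, Ne.symm hax] using hx
        obtain ⟨ih1, ih2⟩ := ih h hx'
        have hxe := exd_of_succ h hx'
        have hq := A_ne_bottom h hx' hxe.1
        have hpb' : A m k x ≠ b := by
          rintro rfl
          exact hpb (by rw [pred, A_1_A h hx']; exact ne_nilDart_of_exd h hxe.1)
        have hsa' : A (B m k x) k a = nilDart := by
          rw [A_B h, if_neg hax, not_not.1 hsa]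
        have hba := A_ne_bottom h hx' ha
        have hcA : cA m k a = bottom m k a := if_pos (not_not.1 hsa)
        -- Since `a` has no successor, its first dart is its image under `cA`.
        have hbB : bottom (B m k x) k a =
            Equiv.swap (A m k x) (bottom m k x) (bottom m k a) := by
          rw [← hcA, ← ih2 a ha, cA, if_pos hsa']
        have hprec : prec_L (B m k x) k a b := by
          refine ⟨exd_B.2 ha, exd_B.2 hb', not_not.2 hsa',
            not_not.2 (A_1_B_eq_nilDart (not_not.1 hpb) h), ?_⟩
          rw [ih2 a ha, hcA, Equiv.swap_apply_def]
          grind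
        simp only [B, if_true, if_neg hax]
        refine ⟨⟨ih1, hprec⟩, fun z hz => ?_⟩
        rw [cA_L ih1 hprec (exd_B.2 hz), cA_L h hp hz, ih2 z hz, hbB]
        simp only [A, bottom, if_true, if_neg (Ne.symm hax), Equiv.swap_apply_def]
        -- What remains is a conjugation of transpositions, with two cases: either `b` is fixed by
        -- the swap of `A m k x` and `bottom m k x`, or `b = bottom m k x` and the link from `a` has
        -- moved the first dart of `x` to that of `a`.
        generalize cA m k z = w
        grind
    · have hx' : succ m k x := by
        simpa only [succ, A, if_neg hk] using hx
      obtain ⟨ih1, ih2⟩ := ih h hx'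
      simp only [B, if_neg hk]
      obtain ⟨ha, hb', hsa, hpb, hc⟩ := hp
      refine ⟨⟨ih1, exd_B.2 ha, exd_B.2 hb', ?_, ?_, ?_⟩, fun z hz => ?_⟩
      · rwa [succ, A_B_of_ne (Ne.symm hk)]
      · rwa [pred, A_1_B_of_ne (Ne.symm hk)]
      · rwa [cA_B_of_ne (Ne.symm hk)]
      · rw [cA_L_of_ne hk, cA_L_of_ne hk, ih2 z hz]
        simp only [A, bottom, if_neg hk]

end FMap

/-! ### Components of a free map as the equivalence generated by its links. -/

namespace FMap

theorem bottom_B {m : FMap} {k : Dim} {x z : Dart} (h : inv_hmap m) (hx : succ m k x)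
    (hne : bottom m k z ≠ bottom m k x) : bottom (B m k x) k z = bottom m k z := by
  induction m generalizing z with
  | V => rfl
  | I m a ih =>
    have hax : x ≠ a := fun e => h.2.2 (e ▸ (exd_of_succ h.1 hx).1)
    have := fun hne => @ih z h.1 hx hne
    simp only [B, bottom] at *
    grind
  | L m k₀ a b ih =>
    obtain ⟨h, hp⟩ := h
    by_cases hk : k = k₀
    · subst hk
      have hb := bottom_ne_of_prec_L hp
      by_cases hax : a = x
      · subst hax
        simp only [B, bottom] at *
        grind
      · have hx' : succ m k x := by
          simpa [succ, A, Ne.symm hax] using hx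
        have h1 := fun hne => @ih z h hx' hne
        have h2 := fun hne => @ih a h hx' hne
        simp only [B, bottom, if_true, if_neg hax] at *
        grind
    · have hx' : succ m k x := by
        simpa only [succ, A, if_neg hk] using hx
      simp only [B, bottom, if_neg hk] at *
      exact ih h hx' hne

theorem finite_exd (m : FMap) : {z | exd m z}.Finite := by
  induction m with
  | V => exact Set.finite_empty
  | I m x ih => exact (ih.insert x)
  | L m k x y ih => exact ih

/-- An equivalence that contains the `k`-links contains the pairs of a dart and the first dart of
its open `k`-orbit. -/
theorem rel_bottom {m : FMap} {k : Dim} {r : Setoid Dart} (h : inv_hmap m)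
    (hr : ∀ z, succ m k z → r z (A m k z)) {z : Dart} (hz : exd m z) : r z (bottom m k z) := by
  induction m generalizing z with
  | V => exact hz.elim
  | I m x ih =>
    simp only [bottom]
    split_ifs with h1
    · rw [h1]
    · exact ih h.1 hr (hz.resolve_left h1)
  | L m k₀ x y ih =>
    obtain ⟨h, hx, hy, hsx, hpy, -⟩ := h
    simp only [bottom]
    by_cases hk : k = k₀
    · subst hk
      have hr' : ∀ z, succ m k z → r z (A m k z) := fun w hw => by
        have hwx : w ≠ x := fun e => hsx (e ▸ hw)
        have := hr w
        simp only [succ, A, if_true, if_neg hwx] at this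
        exact this hw
      have hxy : r x y := by
        have := hr x
        simp only [succ, A, if_true] at this
        exact this (ne_nilDart_of_exd h hy)
      rw [if_pos rfl]
      split_ifs with h1
      · exact Setoid.trans' _ (h1 ▸ ih h hr' hz) (Setoid.trans' _ (Setoid.symm' _ hxy) (ih h hr' hx))
      · exact ih h hr' hz
    · rw [if_neg hk]
      refine ih h (fun w hw => ?_) hz
      have := hr w
      simp only [succ, A, if_neg hk] at this
      exact this hw

theorem rel_cA {m : FMap} {k : Dim} {r : Setoid Dart} (h : inv_hmap m)
    (hr : ∀ z, succ m k z → r z (A m k z)) {z : Dart} (hz : exd m z) : r z (cA m k z) := by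
  unfold cA
  split_ifs with h1
  · exact rel_bottom h hr hz
  · exact hr z h1

/-- This is the minimality of `eqc` among equivalences containing the links; `eqc_A` shows that it
contains them. -/
theorem rel_of_eqc {m : FMap} {r : Setoid Dart} (h : inv_hmap m)
    (hr : ∀ k z, succ m k z → r z (A m k z)) {z t : Dart} (hzt : eqc m z t) : r z t := by
  induction m generalizing z t with
  | V => exact hzt.elim
  | I m x ih =>
    rcases hzt with ⟨rfl, rfl⟩ | hzt
    · exact Setoid.refl' _ _
    · exact ih h.1 hr hzt
  | L m k₀ x y ih =>
    obtain ⟨h, hx, hy, hsx, hpy, -⟩ := h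
    have hr' : ∀ k z, succ m k z → r z (A m k z) := fun k w hw => by
      have hwx : k = k₀ → w ≠ x := fun hk e => hsx (e ▸ hk ▸ hw)
      have := hr k w
      by_cases hk : k = k₀
      · simp only [succ, A, if_pos hk, if_neg (hwx hk)] at this
        exact this hw
      · simp only [succ, A, if_neg hk] at this
        exact this hw
    have hxy : r x y := by
      have := hr k₀ x
      simp only [succ, A, if_true] at this
      exact this (ne_nilDart_of_exd h hy)
    rcases hzt with hzt | ⟨h1, h2⟩ | ⟨h1, h2⟩
    · exact ih h hr' hzt
    · exact Setoid.trans' _ (Setoid.trans' _ (ih h hr' h1) hxy) (ih h hr' h2)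
    · exact Setoid.trans' _ (Setoid.trans' _ (ih h hr' h1) (Setoid.symm' _ hxy)) (ih h hr' h2)

theorem exd_of_eqc {m : FMap} {z t : Dart} (h : eqc m z t) : exd m z ∧ exd m t := by
  induction m generalizing z t with
  | V => exact h.elim
  | I m x ih =>
    rcases h with ⟨h1, h2⟩ | h
    · exact ⟨Or.inl h1, Or.inl h2⟩
    · exact ⟨Or.inr (ih h).1, Or.inr (ih h).2⟩
  | L m k x y ih =>
    rcases h with h | ⟨h, h'⟩ | ⟨h, h'⟩
    · exact ih h
    · exact ⟨(ih h).1, (ih h').2⟩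
    · exact ⟨(ih h).1, (ih h').2⟩

theorem eqc_refl {m : FMap} {z : Dart} (h : exd m z) : eqc m z z := by
  induction m with
  | V => exact h
  | I m x ih => exact h.imp (fun h => ⟨h, h⟩) ih
  | L m k x y ih => exact Or.inl (ih h)

theorem eqc_symm {m : FMap} {z t : Dart} (h : eqc m z t) : eqc m t z := by
  induction m generalizing z t with
  | V => exact h
  | I m x ih => exact h.imp And.symm ih
  | L m k x y ih =>
    rcases h with h | ⟨h, h'⟩ | ⟨h, h'⟩
    · exact Or.inl (ih h)
    · exact Or.inr (Or.inr ⟨ih h', ih h⟩)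
    · exact Or.inr (Or.inl ⟨ih h', ih h⟩)

theorem eqc_trans {m : FMap} {z t u : Dart} (hm : inv_hmap m) (h : eqc m z t)
    (h' : eqc m t u) : eqc m z u := by
  induction m generalizing z t u with
  | V => exact h
  | I m x ih =>
    rcases h with ⟨rfl, rfl⟩ | h <;> rcases h' with ⟨h1, rfl⟩ | h'
    · exact Or.inl ⟨rfl, rfl⟩
    · exact absurd (exd_of_eqc h').1 hm.2.2
    · exact absurd (h1 ▸ (exd_of_eqc h).2) hm.2.2
    · exact Or.inr (ih hm.1 h h')
  | L m k x y ih =>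
    have h1 : ∀ {u v w}, eqc m u v → eqc m v w → eqc m u w := fun p q => ih hm.1 p q
    have h2 : ∀ {u v}, eqc m u v → eqc m v u := fun p => eqc_symm p
    simp only [eqc] at *
    grind

theorem eqc_A {m : FMap} {k : Dim} {z : Dart} (h : inv_hmap m) (hz : succ m k z) :
    eqc m z (A m k z) := by
  induction m with
  | V => exact absurd rfl hz
  | I m x ih => exact Or.inr (ih h.1 hz)
  | L m k₀ x y ih =>
    obtain ⟨h, hx, hy, -⟩ := h
    simp only [succ, A, eqc] at hz ih ⊢
    split_ifs at hz ⊢ with h1 h2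
    · subst h2
      exact Or.inr (Or.inl ⟨eqc_refl hx, eqc_refl hy⟩)
    · exact Or.inl (ih h hz)
    · exact Or.inl (ih h hz)

theorem eqc_cA {m : FMap} {k : Dim} {z : Dart} (h : inv_hmap m) (hz : exd m z) :
    eqc m z (cA m k z) := by
  -- `eqc` is reflexive only on existing darts, so equality is adjoined to get an equivalence on all
  -- naturals.
  let r : Setoid Dart :=
    { r := fun a b => a = b ∨ eqc m a b
      iseqv :=
        { refl := fun a => Or.inl rfl
          symm := by
            rintro a b (rfl | hab)
            exacts [Or.inl rfl, Or.inr (eqc_symm hab)]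
          trans := by
            rintro a b c (rfl | hab) (rfl | hbc)
            exacts [Or.inl rfl, Or.inr hbc, Or.inr hab, Or.inr (eqc_trans h hab hbc)] } }
  have : r z (cA m k z) := rel_cA h (fun w hw => Or.inr (eqc_A h hw)) hz
  rcases this with e | e
  · rw [← e]
    exact eqc_refl hz
  · exact e

/-! ### Free maps as hypermaps -/

/-- The free map `m` has the darts, edges and vertices of the hypermap `M`, up to the
numbering `ι` of the darts of `M`. -/
structure Represents (m : FMap) {D : Type*} (M : Hypermap D) (ι : D → Dart) : Prop where
  injective : Function.Injective ι
  exd_iff : ∀ z, exd m z ↔ ∃ d, ι d = z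
  cA_zero : ∀ d, ι (M.α₀ d) = cA m Dim.zero (ι d)
  cA_one : ∀ d, ι (M.α₁ d) = cA m Dim.one (ι d)

/-- The closure of the `k`-links as a permutation of the existing darts. -/
def cAPerm (m : FMap) (h : inv_hmap m) (k : Dim) : Equiv.Perm {z // exd m z} where
  toFun z := ⟨cA m k z.1, exd_cA h z.2⟩
  invFun z := ⟨cA_1 m k z.1, exd_cA_1 h z.2⟩
  left_inv z := Subtype.ext (cA_1_cA h z.2)
  right_inv z := Subtype.ext (cA_cA_1 h z.2)

/-- The hypermap of a free map. -/
def toHypermap (m : FMap) (h : inv_hmap m) : Hypermap {z // exd m z} where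
  α₀ := cAPerm m h Dim.zero
  α₁ := cAPerm m h Dim.one

theorem represents_toHypermap (m : FMap) (h : inv_hmap m) :
    m.Represents (m.toHypermap h) Subtype.val where
  injective := Subtype.val_injective
  exd_iff z := by simp
  cA_zero _ := rfl
  cA_one _ := rfl

namespace Represents

variable {m : FMap} {D : Type*} {M : Hypermap D} {ι : D → Dart}

theorem exd (h : m.Represents M ι) (d : D) : m.exd (ι d) := (h.exd_iff _).2 ⟨d, rfl⟩

theorem apply_φ (h : m.Represents M ι) (hm : inv_hmap m) (d : D) :
    ι (M.φ d) = cF m (ι d) := by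
  have h0 : ∀ w, ι (M.α₀⁻¹ w) = cA_1 m Dim.zero (ι w) := fun w => by
    have e := h.cA_zero (M.α₀⁻¹ w)
    rw [show M.α₀ (M.α₀⁻¹ w) = w from M.α₀.apply_symm_apply w] at e
    rw [e, cA_1_cA hm (h.exd _)]
  have h1 : ∀ w, ι (M.α₁⁻¹ w) = cA_1 m Dim.one (ι w) := fun w => by
    have e := h.cA_one (M.α₁⁻¹ w)
    rw [show M.α₁ (M.α₁⁻¹ w) = w from M.α₁.apply_symm_apply w] at e
    rw [e, cA_1_cA hm (h.exd _)]
  rw [Hypermap.φ, Equiv.Perm.mul_apply, h1, h0, cF]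

theorem numClasses_eq (h : m.Represents M ι) {s : Setoid D} {r : Dart → Dart → Prop}
    (hr : ∀ a t, r (ι a) t ↔ ∃ b, ι b = t ∧ s a b) :
    numClasses m r = Nat.card (Quotient s) := by
  have e : (fun z => {t | r z t}) '' {z | m.exd z} = Set.range fun a => {t | r (ι a) t} := by
    ext S
    simp only [Set.mem_image, Set.mem_ofPred_eq, h.exd_iff, Set.mem_range]
    constructor
    · rintro ⟨_, ⟨d, rfl⟩, rfl⟩
      exact ⟨d, rfl⟩
    · rintro ⟨d, rfl⟩
      exact ⟨_, ⟨d, rfl⟩, rfl⟩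
  rw [numClasses, e, Setoid.ncard_range_eq_card_quotient s]
  intro a b
  simp only [Set.ext_iff, Set.mem_ofPred_eq, hr]
  constructor
  · intro h'
    obtain ⟨c, hc, hac⟩ := (h' (ι b)).2 ⟨b, rfl, s.refl b⟩
    rwa [h.injective hc] at hac
  · exact fun hab t => exists_congr fun c => and_congr_right fun _ =>
      ⟨fun hac => s.trans (s.symm hab) hac, fun hbc => s.trans hab hbc⟩

theorem eqc_iff (h : m.Represents M ι) (hm : inv_hmap m) (a : D) (t : Dart) :
    eqc m (ι a) t ↔ ∃ b, ι b = t ∧ M.componentSetoid a b := by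
  constructor
  · intro hat
    obtain ⟨b, rfl⟩ := (h.exd_iff t).1 (exd_of_eqc hat).2
    refine ⟨b, rfl, ?_⟩
    -- The component relation is transported along `ι` to all naturals; numbers that are not darts
    -- are sent to the empty set and form one harmless class.
    let r : Setoid Dart := Setoid.ker fun z => {u | ∃ v, ι v = z ∧ M.componentSetoid v u}
    have hr : ∀ u v, r (ι u) (ι v) ↔ M.componentSetoid u v := fun u v => by
      change {w | ∃ v, ι v = ι u ∧ _} = {w | ∃ u, ι u = ι v ∧ _} ↔ _
      simp only [h.injective.eq_iff, exists_eq_left, Set.ext_iff, Set.mem_ofPred_eq]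
      exact ⟨fun e => (e v).2 (Setoid.refl' _ _), fun e w =>
        ⟨Setoid.trans' _ (Setoid.symm' _ e), Setoid.trans' _ e⟩⟩
    rw [← hr]
    refine rel_of_eqc hm (fun k z hz => ?_) hat
    obtain ⟨d, rfl⟩ := (h.exd_iff z).1 (exd_of_succ hm hz).1
    have hA : A m k (ι d) = cA m k (ι d) := (if_neg hz).symm
    cases k with
    | zero =>
      rw [hA, ← h.cA_zero, hr]
      exact (le_sup_left : _ ≤ M.componentSetoid)
        (Equiv.Perm.sameCycle_apply_right.2 (.refl _ _))
    | one =>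
      rw [hA, ← h.cA_one, hr]
      exact (le_sup_right : _ ≤ M.componentSetoid)
        (Equiv.Perm.sameCycle_apply_right.2 (.refl _ _))
  · rintro ⟨b, rfl, hab⟩
    let s : Setoid D :=
      { r := fun u v => eqc m (ι u) (ι v)
        iseqv :=
          { refl := fun u => eqc_refl (h.exd u)
            symm := eqc_symm
            trans := eqc_trans hm } }
    have hs : M.componentSetoid ≤ s :=
      sup_le (Equiv.Perm.sameCycle_setoid_le fun z => by
          change eqc m _ _
          rw [h.cA_zero]
          exact eqc_cA hm (h.exd z))
        (Equiv.Perm.sameCycle_setoid_le fun z => by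
          change eqc m _ _
          rw [h.cA_one]
          exact eqc_cA hm (h.exd z))
    exact hs hab

theorem B (h : m.Represents M ι) (hm : inv_hmap m) {u v x : D}
    (hx : succ m Dim.zero (ι x))
    (huv : ι u = A m Dim.zero (ι x) ∧ ι v = bottom m Dim.zero (ι x) ∨
      ι u = bottom m Dim.zero (ι x) ∧ ι v = A m Dim.zero (ι x)) :
    (m.B Dim.zero (ι x)).Represents (M.breakLink (u, v)) ι where
  injective := h.injective
  exd_iff z := by rw [exd_B, h.exd_iff]
  cA_zero d := by
    classical
    have hs : Equiv.swap (A m Dim.zero (ι x)) (bottom m Dim.zero (ι x)) =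
        Equiv.swap (ι u) (ι v) := by
      rcases huv with ⟨h1, h2⟩ | ⟨h1, h2⟩
      · rw [h1, h2]
      · rw [h1, h2, Equiv.swap_comm]
    rw [(inv_hmap_B_and_cA_B hm hx).2 _ (h.exd d), hs, ← h.cA_zero, h.injective.swap_apply,
      Hypermap.breakLink_α₀, Equiv.Perm.mul_apply]
  cA_one d := by
    rw [cA_B_of_ne (by simp)]
    exact h.cA_one d

variable [Finite D]

theorem expo_iff (h : m.Represents M ι) {f : Dart → Dart} {σ : Equiv.Perm D}
    (hf : ∀ d, ι (σ d) = f (ι d)) (a : D) (t : Dart) :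
    expo m f (ι a) t ↔ ∃ b, ι b = t ∧ σ.SameCycle a b := by
  have hi : ∀ i : ℕ, f^[i] (ι a) = ι ((σ ^ i) a) := fun i => by
    induction i with
    | zero => rfl
    | succ i ih => rw [Function.iterate_succ_apply', ih, ← hf, pow_succ', Equiv.Perm.mul_apply]
  constructor
  · rintro ⟨-, i, rfl⟩
    exact ⟨_, (hi i).symm, i, by rw [zpow_natCast]⟩
  · rintro ⟨_, rfl, hab⟩
    obtain ⟨i, -, rfl⟩ := hab.exists_pow_eq'
    exact ⟨h.exd a, i, hi i⟩

theorem expe_iff (h : m.Represents M ι) (a b : D) :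
    expe m (ι a) (ι b) ↔ M.α₀.SameCycle a b := by
  rw [expe, h.expo_iff h.cA_zero]
  simp only [h.injective.eq_iff, exists_eq_left]

theorem expf_iff (h : m.Represents M ι) (hm : inv_hmap m) (a b : D) :
    expf m (ι a) (ι b) ↔ M.φ.SameCycle a b := by
  rw [expf, h.expo_iff (h.apply_φ hm)]
  simp only [h.injective.eq_iff, exists_eq_left]

theorem nc_eq (h : m.Represents M ι) (hm : inv_hmap m) : nc m = M.numComponents := by
  rw [M.numComponents_eq]
  exact h.numClasses_eq (h.eqc_iff hm)

theorem ec_eq (h : m.Represents M ι) (hm : inv_hmap m) : ec m = M.eulerChar := by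
  have h0 : ne m = M.numEdges := by
    rw [M.numEdges_eq]
    exact h.numClasses_eq (h.expo_iff h.cA_zero)
  have h1 : nv m = M.numVertices := by
    rw [M.numVertices_eq]
    exact h.numClasses_eq (h.expo_iff h.cA_one)
  have h2 : nf m = M.numFaces := by
    rw [M.numFaces_eq]
    exact h.numClasses_eq (h.expo_iff (h.apply_φ hm))
  have h3 : nd m = M.numDarts := by
    have e : {z | m.exd z} = Set.range ι := Set.ext fun z => h.exd_iff z
    rw [nd, e, ← Set.image_univ, Set.ncard_image_of_injective _ h.injective, Set.ncard_univ,
      Hypermap.numDarts]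
  rw [ec, h0, h1, h2, h3, Hypermap.eulerChar]

/-- The genus theorem makes `χ` even, so the floor in the free-map genus agrees with the exact
division. -/
theorem planar_iff (h : m.Represents M ι) (hm : inv_hmap m) : planar m ↔ M.Planar := by
  obtain ⟨g, hg⟩ := M.exists_two_mul_numComponents_eq
  rw [Hypermap.planar_iff, planar, genus, h.nc_eq hm, h.ec_eq hm]
  omega

end Represents

end FMap

/-! ### Rings and successive breaks coded by lists. -/

namespace FMap

theorem distinct_edge_list_iff {m : FMap} {x : Dart} {l : List (Dart × Bool)} :
    distinct_edge_list m x l ↔ ∀ xb ∈ l, ¬ expe m x xb.1 := by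
  induction l with
  | nil => simp [distinct_edge_list]
  | cons a l ih => simp [distinct_edge_list, ih, and_comm]

theorem distinct_face_list_iff {m : FMap} {xb : Dart × Bool} {l : List (Dart × Bool)} :
    distinct_face_list m xb l ↔ ∀ xb' ∈ l, ¬ expf m (faceDart m xb) (faceDart m xb') := by
  induction l with
  | nil => simp [distinct_face_list]
  | cons a l ih => simp [distinct_face_list, ih, and_comm]

theorem pre_ring0_iff {m : FMap} {l : List (Dart × Bool)} :
    pre_ring0 m l ↔ l.Pairwise (fun xb xb' => ¬ expe m xb.1 xb'.1) ∧
      ∀ xb ∈ l, succ m Dim.zero xb.1 := by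
  induction l with
  | nil => simp [pre_ring0]
  | cons a l ih =>
    simp only [pre_ring0, ih, distinct_edge_list_iff, List.pairwise_cons, List.forall_mem_cons]
    tauto

theorem pre_ring1_iff {m : FMap} {l : List (Dart × Bool)} :
    pre_ring1 m l ↔ l.IsChain (adjacent_faces m) := by
  induction l with
  | nil => simp [pre_ring1]
  | cons a l ih =>
    cases l with
    | nil => simp [pre_ring1]
    | cons b l => rw [pre_ring1, ih, List.isChain_cons_cons, and_comm]

theorem pre_ring3_iff {m : FMap} {l : List (Dart × Bool)} :
    pre_ring3 m l ↔
      l.Pairwise fun xb xb' => ¬ expf m (faceDart m xb) (faceDart m xb') := by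
  induction l with
  | nil => simp [pre_ring3]
  | cons a l ih => rw [pre_ring3, ih, distinct_face_list_iff, List.pairwise_cons, and_comm]

theorem exd_faceDart {m : FMap} {xb : Dart × Bool} (h : inv_hmap m)
    (hx : succ m Dim.zero xb.1) : exd m (faceDart m xb) ∧ exd m (otherDart m xb) := by
  have h1 := exd_of_succ h hx
  have h2 := exd_bottom (k := Dim.zero) h h1.1
  unfold faceDart otherDart
  split_ifs
  exacts [⟨h1.2, h2⟩, ⟨h2, h1.2⟩]

theorem succ_B {m : FMap} {k : Dim} {x z : Dart} (h : inv_hmap m) (hne : z ≠ x)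
    (hz : succ m k z) : succ (B m k x) k z := by
  rwa [succ, A_B h, if_neg hne]

theorem expe_refl {m : FMap} {z : Dart} (hz : m.exd z) : expe m z z :=
  ⟨hz, 0, rfl⟩

namespace Represents

variable {m : FMap} {D : Type*} {M : Hypermap D} {ι : D → Dart}

theorem sameCycle_of_eq_A (h : m.Represents M ι) {d u : D} (hx : succ m Dim.zero (ι d))
    (hu : ι u = A m Dim.zero (ι d)) : M.α₀.SameCycle d u := by
  have hA : ι u = ι (M.α₀ d) := by
    rw [h.cA_zero, hu]
    exact (if_neg hx).symm
  rw [h.injective hA]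
  exact Equiv.Perm.sameCycle_apply_right.2 (.refl _ _)

variable [Finite D]

theorem expe_of_bottom_eq (h : m.Represents M ι) (hm : inv_hmap m) {x z : Dart}
    (hx : m.exd x) (hz : m.exd z) (e : bottom m Dim.zero x = bottom m Dim.zero z) :
    expe m x z := by
  let r : Setoid Dart := Setoid.ker fun w => {u | expe m w u}
  have hr : ∀ u v, r (ι u) (ι v) ↔ M.α₀.SameCycle u v := fun u v => by
    change {w | expe m (ι u) w} = {w | expe m (ι v) w} ↔ _
    simp only [Set.ext_iff, Set.mem_ofPred_eq, expe, h.expo_iff h.cA_zero]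
    constructor
    · intro e
      obtain ⟨c, hc, huc⟩ := (e (ι v)).2 ⟨v, rfl, .refl _ _⟩
      rwa [h.injective hc] at huc
    · exact fun e t => exists_congr fun c => and_congr_right fun _ =>
        ⟨fun e' => e.symm.trans e', fun e' => e.trans e'⟩
  have hb : ∀ {w}, m.exd w → r w (bottom m Dim.zero w) := fun hw =>
    rel_bottom hm (fun w hw => by
      have hA : A m Dim.zero w = cA m Dim.zero w := (if_neg hw).symm
      obtain ⟨d, rfl⟩ := (h.exd_iff w).1 (exd_of_succ hm hw).1
      rw [hA, ← h.cA_zero, hr]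
      exact Equiv.Perm.sameCycle_apply_right.2 (.refl _ _)) hw
  have hxz : r x z := Setoid.trans' _ (hb hx) (e ▸ Setoid.symm' _ (hb hz))
  obtain ⟨a, rfl⟩ := (h.exd_iff x).1 hx
  obtain ⟨b, rfl⟩ := (h.exd_iff z).1 hz
  rw [h.expe_iff, ← hr]
  exact hxz

theorem sameCycle_of_eq_bottom (h : m.Represents M ι) (hm : inv_hmap m) {d u : D}
    (hu : ι u = bottom m Dim.zero (ι d)) : M.α₀.SameCycle d u := by
  rw [← h.expe_iff]
  refine h.expe_of_bottom_eq hm (h.exd d) (h.exd u) ?_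
  rw [← hu, bottom_eq_self hm (h.exd u)]
  rw [hu, A_1_bottom hm (h.exd d)]

theorem sameCycle_faceDart (h : m.Represents M ι) (hm : inv_hmap m) {d u : D} {b : Bool}
    (hx : succ m Dim.zero (ι d)) (hu : ι u = faceDart m (ι d, b)) : M.α₀.SameCycle d u := by
  unfold faceDart at hu
  split_ifs at hu
  exacts [h.sameCycle_of_eq_A hx hu, h.sameCycle_of_eq_bottom hm hu]

theorem sameCycle_otherDart (h : m.Represents M ι) (hm : inv_hmap m) {d u : D} {b : Bool}
    (hx : succ m Dim.zero (ι d)) (hu : ι u = otherDart m (ι d, b)) : M.α₀.SameCycle d u := by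
  unfold otherDart at hu
  split_ifs at hu
  exacts [h.sameCycle_of_eq_bottom hm hu, h.sameCycle_of_eq_A hx hu]

/-- A break does not change the double-links coded by the darts of the other edges. -/
theorem faceDart_B (h : m.Represents M ι) (hm : inv_hmap m) {x : Dart} {xb : Dart × Bool}
    (hx : succ m Dim.zero x) (hxb : succ m Dim.zero xb.1) (hne : ¬ expe m x xb.1) :
    faceDart (m.B Dim.zero x) xb = faceDart m xb ∧
      otherDart (m.B Dim.zero x) xb = otherDart m xb := by
  have hex := (exd_of_succ hm hx).1
  have h1 : A (m.B Dim.zero x) Dim.zero xb.1 = A m Dim.zero xb.1 := by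
    rw [A_B hm, if_neg]
    rintro e
    rw [e] at hne
    exact hne (expe_refl hex)
  have h2 : bottom (m.B Dim.zero x) Dim.zero xb.1 = bottom m Dim.zero xb.1 :=
    bottom_B hm hx fun e => hne (h.expe_of_bottom_eq hm hex (exd_of_succ hm hxb).1 e.symm)
  simp only [faceDart, otherDart, h1, h2, and_self]

/-- The double-links in `R` are computed once, in the original `m`. Unicity keeps them valid along
the deletions, since each one leaves the other edges and their codes intact. -/
theorem Bl {l : List (Dart × Bool)} {R : List (D × D)} (h : m.Represents M ι)
    (hm : inv_hmap m) (hl : pre_ring0 m l)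
    (hR : R.map (Prod.map ι ι) = l.map fun xb => (faceDart m xb, otherDart m xb)) :
    (m.Bl l).Represents (M.breakAlong R) ι ∧ inv_hmap (m.Bl l) := by
  induction l generalizing m M R with
  | nil =>
    rw [List.map_nil, List.map_eq_nil_iff] at hR
    subst hR
    exact ⟨h, hm⟩
  | cons xb l ih =>
    obtain ⟨⟨u, v⟩, R, rfl, huv, hR'⟩ := List.map_eq_cons_iff.1 hR
    rw [pre_ring0_iff, List.pairwise_cons, List.forall_mem_cons] at hl
    obtain ⟨⟨hd, hl⟩, hx, hs⟩ := hl
    obtain ⟨x, b⟩ := xb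
    obtain ⟨d, rfl⟩ := (h.exd_iff x).1 (exd_of_succ hm hx).1
    simp only [Prod.map_apply, Prod.mk.injEq] at huv
    have hsame := (h.sameCycle_faceDart hm hx huv.1).symm.trans (h.sameCycle_otherDart hm hx huv.2)
    simp only [faceDart, otherDart] at huv
    have hB := h.B hm hx (u := u) (v := v) (by cases b <;> simp_all)
    have hinv := (inv_hmap_B_and_cA_B hm hx).1
    have hBl := @ih (m.B Dim.zero (ι d)) (M.breakLink (u, v)) R hB hinv
    refine hBl ?_ (hR'.trans (List.map_congr_left fun xb hxb => ?_))
    · rw [pre_ring0_iff]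
      refine ⟨(List.Pairwise.and_mem.1 hl).imp fun {a c} ⟨ha, hc, hac⟩ e => hac ?_,
        fun xb hxb => succ_B hm (fun e => hd xb hxb (by rw [e]; exact expe_refl (h.exd d))) (hs xb hxb)⟩
      obtain ⟨a', ha'⟩ := (h.exd_iff a.1).1 (exd_of_succ hm (hs a ha)).1
      obtain ⟨c', hc'⟩ := (h.exd_iff c.1).1 (exd_of_succ hm (hs c hc)).1
      rw [← ha', ← hc', hB.expe_iff] at e
      rw [← ha', ← hc', h.expe_iff]
      exact Hypermap.sameCycle_α₀_of_breakLink hsame e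
    · rw [(h.faceDart_B hm hx (hs xb hxb) (hd xb hxb)).1,
        (h.faceDart_B hm hx (hs xb hxb) (hd xb hxb)).2]

theorem expf_symm (h : m.Represents M ι) (hm : inv_hmap m) {z t : Dart} (hzt : expf m z t) :
    expf m t z := by
  obtain ⟨a, rfl⟩ := (h.exd_iff z).1 hzt.1
  obtain ⟨b, rfl, hab⟩ := (h.expo_iff (h.apply_φ hm) a t).1 hzt
  exact (h.expf_iff hm b a).2 hab.symm

/-- The ring of faces coded by a list, as a sequence of double-links of `M`. -/
theorem isRing (h : m.Represents M ι) (hm : inv_hmap m) {l : List (Dart × Bool)} {g : Dart → D}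
    (hg : ∀ z, m.exd z → ι (g z) = z) (hl : FMap.ring m l) :
    M.IsRing (l.map fun xb => (g (faceDart m xb), g (otherDart m xb))) := by
  obtain ⟨hne, h0, h1, h2, h3⟩ := hl
  rw [pre_ring0_iff] at h0
  rw [pre_ring1_iff] at h1
  rw [pre_ring3_iff] at h3
  obtain ⟨h0, hs⟩ := h0
  have hd : ∀ xb ∈ l, ∃ d, ι d = xb.1 := fun xb hxb =>
    (h.exd_iff _).1 (exd_of_succ hm (hs xb hxb)).1
  have hf : ∀ xb ∈ l, ι (g (faceDart m xb)) = faceDart m xb := fun xb hxb =>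
    hg _ (exd_faceDart hm (hs xb hxb)).1
  have ho : ∀ xb ∈ l, ι (g (otherDart m xb)) = otherDart m xb := fun xb hxb =>
    hg _ (exd_faceDart hm (hs xb hxb)).2
  have hef : ∀ xb ∈ l, ∀ d, ι d = xb.1 → M.α₀.SameCycle d (g (faceDart m xb)) := by
    rintro ⟨x, b⟩ hxb d rfl
    exact h.sameCycle_faceDart hm (hs _ hxb) (hf _ hxb)
  have heo : ∀ xb ∈ l, ∀ d, ι d = xb.1 → M.α₀.SameCycle d (g (otherDart m xb)) := by
    rintro ⟨x, b⟩ hxb d rfl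
    exact h.sameCycle_otherDart hm (hs _ hxb) (ho _ hxb)
  have hadj : ∀ xb ∈ l, ∀ xb' ∈ l, adjacent_faces m xb xb' →
      Hypermap.Adjacent (M.face (g (faceDart m xb))) (M.face (g (faceDart m xb')))
        (g (faceDart m xb), g (otherDart m xb)) := by
    intro xb hxb xb' hxb' hadj
    rw [adjacent_faces, ← ho xb hxb, ← hf xb' hxb', h.expf_iff hm] at hadj
    exact ⟨(M.mem_face).2 (.refl _ _), (M.mem_face).2 hadj.symm⟩
  refine ⟨by simpa using hne, ?_, ?_, ?_, ?_, ?_⟩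
  · intro p hp
    obtain ⟨xb, hxb, rfl⟩ := List.mem_map.1 hp
    obtain ⟨d, hd⟩ := hd xb hxb
    refine ⟨fun e => ?_, (M.mem_edge).2 ((hef xb hxb d hd).symm.trans (heo xb hxb d hd))⟩
    have e' : faceDart m xb = otherDart m xb := by
      rw [← hf xb hxb, ← ho xb hxb]
      exact congrArg ι e
    have hA := A_ne_bottom hm (hs xb hxb) (exd_of_succ hm (hs xb hxb)).1
    unfold faceDart otherDart at e'
    split_ifs at e'
    exacts [hA e', hA e'.symm]
  · rw [List.pairwise_map]
    refine (List.Pairwise.and_mem.1 h0).imp fun {a c} ⟨ha, hc, hac⟩ e => hac ?_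
    obtain ⟨u, hu⟩ := hd a ha
    obtain ⟨v, hv⟩ := hd c hc
    rw [M.edge_eq_iff] at e
    rw [← hu, ← hv, h.expe_iff]
    exact ((hef a ha u hu).trans e).trans (hef c hc v hv).symm
  · rw [List.isChain_map]
    exact h1.imp_of_mem_imp fun a c ha hc hac => hadj a ha c hc hac
  · rw [List.getLast_map, List.head_map]
    apply hadj _ (List.getLast_mem hne) _ (List.head_mem hne)
    -- For a single link, `pre_ring2` fixes the direction from `A` to `bottom` whatever the Boolean,
    -- so one case needs symmetry of `expf`.
    match l, hne, h2 with
    | [(x, b)], _, h2 =>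
      cases b
      · exact h2
      · exact h.expf_symm hm h2
    | a :: c :: l, _, h2 => exact h2
  · rw [List.pairwise_map]
    refine (List.Pairwise.and_mem.1 h3).imp fun {a c} ⟨ha, hc, hac⟩ e => hac ?_
    rw [M.face_eq_iff] at e
    rw [← hf a ha, ← hf c hc, h.expf_iff hm]
    exact e

end Represents

/-- The discrete Jordan curve theorem for free maps. -/
theorem nc_Bl (m : FMap) (l : List (Dart × Bool)) (hm : inv_hmap m) (hp : planar m)
    (hl : FMap.ring m l) : nc (Bl m l) = nc m + 1 := by
  have h := m.represents_toHypermap hm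
  have : Finite {z // exd m z} := m.finite_exd
  -- A total section of the numbering of darts is wanted. A ring is non-empty, so some existing dart
  -- is available as a default value outside the map.
  have hex : ∀ z, ∃ d : {z // exd m z}, exd m z → d.1 = z := by
    obtain ⟨xb, l', e⟩ := List.exists_cons_of_ne_nil hl.1
    have hs := (pre_ring0_iff.1 hl.2.1).2 xb (by simp [e])
    intro z
    by_cases hz : exd m z
    · exact ⟨⟨z, hz⟩, fun _ => rfl⟩
    · exact ⟨⟨_, (exd_of_succ hm hs).1⟩, fun h => absurd h hz⟩
  choose g hg using hex
  have hR := h.isRing hm hg hl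
  obtain ⟨hB, hinv⟩ := h.Bl hm hl.2.1 (R := l.map fun xb =>
      (g (faceDart m xb), g (otherDart m xb))) (by
    rw [List.map_map]
    refine List.map_congr_left fun xb hxb => ?_
    have := exd_faceDart hm ((pre_ring0_iff.1 hl.2.1).2 xb hxb)
    simp only [Function.comp_apply, Prod.map_apply, hg _ this.1, hg _ this.2])
  rw [hB.nc_eq hinv, h.nc_eq hm,
    Hypermap.numComponents_breakAlong _ _ ((h.planar_iff hm).1 hp) hR]
  push_cast
  rfl

end FMap

theorem mainTheorem1 :
    (∀ (D : Type*) [Finite D] (M : Hypermap D) (R : List (D × D)),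
      M.Planar → M.IsRing R →
        (M.breakAlong R).numComponents = M.numComponents + 1) ∧
    (∀ (m : FMap) (l : List (Dart × Bool)),
      FMap.inv_hmap m → FMap.planar m → FMap.ring m l →
        FMap.nc (FMap.Bl m l) = FMap.nc m + 1) :=
  ⟨fun _ _ M R hM hR => M.numComponents_breakAlong R hM hR, FMap.nc_Bl⟩
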